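/- **Setting.** Let $\mathcal A=\{a\in\mathbb R^d:\|a\|_2\le 1\}$ and $f(a)=a^\top Ma$ with $M=\sum_{j=1}^k\lambda_j v_jv_j^\top$, $k\ge1$, $v_j$ orthonormal, $1\ge\lambda_1>|\lambda_2|\ge\dots\ge|\lambda_k|$ ($\lambda_2:=0$ if $k=1$). Put $\Delta=\lambda_1-|\lambda_2|>0$, $\kappa=\lambda_1/\Delta$, $r^*=\max_{\mathcal A}f=\lambda_1$; the optimal actions are $a^*=\pm v_1$. In round $t$ the learner plays $a_t\in\mathcal A$ and observes $f(a_t)+\eta_t$, where $\eta_t$ is zero-mean $1$-sub-Gaussian conditionally on the randomness before it (for example i.i.d. $\mathcal N(0,1)$). **Algorithm (noisy power method with accuracy $\varepsilon\in(0,1/2)$).** With constants $C_L,C_m,C_n$ let $$L=\lfloor C_L\kappa\log(d/\varepsilon)\rfloor+1,\quad \delta=\frac{0.1}{L},\quad n=\Big\lceil \frac{C_n d^2\log^4\!\big(d/(\delta\Delta\varepsilon)\big)}{\Delta^2\varepsilon^2}\Big\rceil,\quad m=C_m d\log(n/\delta).$$ Draw $a_0$ uniformly on the unit sphere. For $l=1,\dots,L$: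 draw $z_1,\dots,z_n$ independently from $\mathcal N(0,\frac1m I_d)$, drawing the whole batch again as long as some $\|z_i\|>1$; play $\tilde a_i=(a_{l-1}+z_i)/2$, observe $r_i=f(\tilde a_i)+\eta_i$, and let $a_l=y/\|y\|$ with $y=\frac mn\sum_{i=1}^n r_iz_i$. Output $a_L$. **Theorem.** If the universal constants $C_L$, $C_m$, $C_n$ are large enough (chosen in this order, how large may depend on the previous ones), there are a universal exponent $q\in\mathbb N$ and a constant $C>0$ depending only on $C_L,C_m,C_n$ such that for all $d$ and all $M$ as above: 1. For every $\varepsilon\in(0,1/2)$ the number of actions taken satisfies $$Ln\le C\,\frac{\kappa d^2}{\Delta^2\varepsilon^2}\,\log^q\!\Big(\frac{d}{\Delta\varepsilon}\Big),$$ all of them lie in $\mathcal A$ almost surely, and with probability at least $0.9$ the output is a unit vector with $\tan\theta(a^*,a_L)\le\varepsilon$ for a choice $a^*\in\{v_1,-v_1\}$ (with $\theta(a^*,a_L)<\pi/2$) and $r^*-f(a_L)\le r^*\varepsilon^2$. 2. (Explore-then-commit.) For every horizon $T\ge1$, run the algorithm with $\varepsilon=\min\{\frac14,\ d^{1/2}\kappa^{1/4}\Delta^{-1/2}T^{-1/4}\}$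 and play its output $a_L$ in all rounds after the first $Ln$ (if $Ln\geq T$, stop exploring after $T$ rounds). With probability at least $0.9$ all actions lie in $\mathcal A$ and $$\sum_{t=1}^T\big(r^*-f(a_t)\big)\le C\sqrt{\kappa^3d^2T}\;\log^q\!\Big(\frac{2dT}{\Delta}\Big).$$ -/

import Mathlib

open MeasureTheory ProbabilityTheory

noncomputable section

namespace BanditEig

/-- The ambient space `ℝ^d` with the Euclidean norm. -/
abbrev E (d : ℕ) := EuclideanSpace ℝ (Fin d)

/-- A stochastic bandit eigenvector problem with a positive eigengap: a symmetric matrix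
`M = ∑ j, lam j • v j (v j)ᵀ` with `v` orthonormal and `1 ≥ lam 0 > |lam 1| ≥ |lam 2| ≥ ⋯`.
The list has `k = r + 1 ≥ 1` terms (the remaining eigenvalues of `M` are zero). -/
structure Problem (d : ℕ) where
  r : ℕ
  lam : Fin (r + 1) → ℝ
  v : Fin (r + 1) → E d
  orthonormal : Orthonormal ℝ v
  antitone_abs : Antitone fun j => |lam j|
  le_one : lam 0 ≤ 1
  gap_pos : (if h : 1 < r + 1 then |lam ⟨1, h⟩| else 0) < lam 0

namespace Problem

variable {d : ℕ} (I : Problem d)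

/-- The matrix `M`. -/
def M : Matrix (Fin d) (Fin d) ℝ :=
  ∑ j, I.lam j • Matrix.vecMulVec (I.v j).ofLp (I.v j).ofLp

/-- The expected reward `f(a) = aᵀ M a`. -/
def f (a : E d) : ℝ := a.ofLp ⬝ᵥ (I.M.mulVec a.ofLp)

/-- The leading eigenvalue `λ₁`. -/
def lam1 : ℝ := I.lam 0

/-- `|λ₂|`, which is `0` if the expansion of `M` has a single term. -/
def absLam2 : ℝ := if h : 1 < I.r + 1 then |I.lam ⟨1, h⟩| else 0

/-- The eigengap `Δ = λ₁ - |λ₂|`. -/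
def gap : ℝ := I.lam1 - I.absLam2

/-- The condition number `κ = λ₁ / Δ`. -/
def kappa : ℝ := I.lam1 / I.gap

/-- The leading eigenvector; the optimal actions are `v1` and `-v1`. -/
def v1 : E d := I.v 0

/-- The optimal reward: the supremum of `f` over the action set, the closed unit ball. -/
def fStar : ℝ := sSup (I.f '' Metric.closedBall 0 1)

/-! ### Parameters of the noisy power method -/

/-- Number of iterations `L = ⌊C_L κ log (d/ε)⌋ + 1`. -/
def numIter (CL ε : ℝ) : ℕ := ⌊CL * I.kappa * Real.log (d / ε)⌋₊ + 1

/-- Failure probability per iteration, `δ = 0.1 / L`. -/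
def delta (CL ε : ℝ) : ℝ := 0.1 / (I.numIter CL ε : ℝ)

/-- Samples per iteration, `n = ⌈C_n d² log⁴(d/(δΔε)) / (Δ²ε²)⌉`. -/
def batchSize (CL Cn ε : ℝ) : ℕ :=
  ⌈Cn * (d : ℝ) ^ 2 * Real.log (d / (I.delta CL ε * I.gap * ε)) ^ 4 / (I.gap ^ 2 * ε ^ 2)⌉₊

/-- Inverse sampling variance, `m = C_m d log (n/δ)`. -/
def precision (CL Cm Cn ε : ℝ) : ℝ :=
  Cm * d * Real.log (I.batchSize CL Cn ε / I.delta CL ε)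

/-- Total number of actions taken by the noisy power method, `L * n`. -/
def numActions (CL Cn ε : ℝ) : ℕ := I.numIter CL ε * I.batchSize CL Cn ε

/-- The accuracy used by explore-then-commit with horizon `T`:
`ε = d^{1/2} κ^{1/4} / (Δ^{1/2} T^{1/4})`, capped at `1/4` so that it lies in `(0, 1/2)`. -/
def etcEps (T : ℕ) : ℝ :=
  min (1 / 4) ((d : ℝ) ^ (1 / 2 : ℝ) * I.kappa ^ (1 / 4 : ℝ) /
    (I.gap ^ (1 / 2 : ℝ) * (T : ℝ) ^ (1 / 4 : ℝ)))

end Problem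

/-! ### The algorithm, as a function of its random seeds and of the observed noise

Exploration rounds are numbered `t = 0, 1, 2, …`; sample `i` of iteration `l` is round `l * n + i`.
In round `t` the algorithm has drawn `z t`, and the observation is `f (action t) + η t`. -/

variable {d : ℕ}

/-- The iterates `a_0, a_1, a_2, …` of the noisy power method with reward function `f`, `n` samples
per iteration and inverse variance `m`: from `a_l`, query the actions `(a_l + z_i)/2`, observe
`r_i = f ((a_l + z_i)/2) + η_i`, and normalize `(m/n) ∑ r_i z_i`. -/
def npmIter (f : E d → ℝ) (n : ℕ) (m : ℝ) (a₀ : E d) (z : ℕ → E d) (η : ℕ → ℝ) : ℕ → E d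
  | 0 => a₀
  | l + 1 =>
    let a := npmIter f n m a₀ z η l
    let y := (m / n) • ∑ i ∈ Finset.range n,
      (f ((1 / 2 : ℝ) • (a + z (l * n + i))) + η (l * n + i)) • z (l * n + i)
    ‖y‖⁻¹ • y

/-- The action played in exploration round `t`. -/
def npmAction (f : E d → ℝ) (n : ℕ) (m : ℝ) (a₀ : E d) (z : ℕ → E d) (η : ℕ → ℝ) (t : ℕ) : E d :=
  (1 / 2 : ℝ) • (npmIter f n m a₀ z η (t / n) + z t)

/-- Explore-then-commit: the `L * n` rounds of the noisy power method with `L` iterations, and the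
output `a_L` in every later round. -/
def etcAction (f : E d → ℝ) (L n : ℕ) (m : ℝ) (a₀ : E d) (z : ℕ → E d) (η : ℕ → ℝ) (t : ℕ) : E d :=
  if t < L * n then npmAction f n m a₀ z η t else npmIter f n m a₀ z η L

/-- Cumulative regret `∑_{t < T} (f* - f (a_t))` of a sequence of actions. -/
def regret (I : Problem d) (act : ℕ → E d) (T : ℕ) : ℝ :=
  ∑ t ∈ Finset.range T, (I.fStar - I.f (act t))

/-! ### The randomness -/

/-- The uniform probability measure on the unit sphere of `ℝ^d`. -/
def sphereUniform (d : ℕ) : Measure (E d) :=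
  (cond (volume : Measure (E d)).toSphere Set.univ).map Subtype.val

/-- The law of an accepted batch: `n` independent samples from `N(0, (1/m) I_d)`, where the whole
batch is drawn again as long as one of its members has norm greater than `1`; that is, the
product law conditioned on all norms being at most `1`. -/
def batchLaw (d n : ℕ) (m : ℝ) : Measure (Fin n → E d) :=
  cond (Measure.pi fun _ => multivariateGaussian (0 : E d) ((1 / m) • (1 : Matrix (Fin d) (Fin d) ℝ)))
    {z | ∀ i, ‖z i‖ ≤ 1}

/-- The σ-algebra generated by everything that precedes the noise of round `t`: the initial point,
the samples of all batches up to and including the current one, and the earlier noise. -/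
abbrev history {Ω : Type*} (n : ℕ) (a₀ : Ω → E d) (z : ℕ → Ω → E d) (η : ℕ → Ω → ℝ) (t : ℕ) :
    MeasurableSpace Ω :=
  MeasurableSpace.comap
    (fun ω => (a₀ ω, (fun s : Fin ((t / n + 1) * n) => z s ω), (fun s : Fin t => η s ω)))
    inferInstance

/-- The random environment of a run with `L` iterations of `n` samples each: `a₀` is uniform on the
sphere; every batch has the law `batchLaw` and is drawn independently of all that happened before
it; the noise is zero-mean `1`-sub-Gaussian conditionally on the randomness before it (the bound on
the conditional moment generating function contains the zero mean). -/
structure IsRun {Ω : Type*} [mΩ : MeasurableSpace Ω] [StandardBorelSpace Ω]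
    (P : Measure Ω) [IsProbabilityMeasure P] (L n : ℕ) (m : ℝ)
    (a₀ : Ω → E d) (z : ℕ → Ω → E d) (η : ℕ → Ω → ℝ) : Prop where
  measurable_init : Measurable a₀
  measurable_z : ∀ t, Measurable (z t)
  measurable_noise : ∀ t, Measurable (η t)
  law_init : P.map a₀ = sphereUniform d
  law_batch : ∀ l < L, P.map (fun ω (i : Fin n) => z (l * n + i) ω) = batchLaw d n m
  indep_batch : ∀ l < L, IndepFun (fun ω (i : Fin n) => z (l * n + i) ω)
    (fun ω => (a₀ ω, (fun s : Fin (l * n) => z s ω), (fun s : Fin (l * n) => η s ω))) P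
  noise : ∀ t < L * n, ∃ hm : history n a₀ z η t ≤ mΩ,
    HasCondSubgaussianMGF (history n a₀ z η t) hm (η t) 1 P

end BanditEig

end

/-! Each batch performs one step of power iteration. Expanding `f ((a + z) / 2)` splits the reward
into a part even in `z` and the linear part `⟪M a, z⟫ / 2` (`Problem.f_half_add`). The truncated
Gaussian is symmetric and rotation invariant, so the even part is uncorrelated with `z`, and the
second moments are `c / m` times the identity with `c ≥ 1/2` (`exists_secondMoment_truncGauss`).
Hence `y` has conditional mean `(c / 2) M a`, and the unknown factor `c / 2` disappears on
normalizing.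

In a fixed unit direction the deviation of `y` from this mean has the tail `2 exp (-n τ² / (4100
m))` (`IsRun.measure_batch_deviation_le`). The noise is integrated out first, sample by sample and
conditionally on the history, at the price of a factor `exp (s² ⟪u, z⟫² / 2)`. Since the batch is
independent of the iterate, the iterate can then be frozen and the `n` samples factorize, leaving a
bound for one sample (`lintegral_exp_truncGauss_le`). A union bound covers all batches and `d + 1`
directions: a basis, which makes the error vector of order `Δ ε`, and `v₁`, along which it must be
of order `Δ / √d`.

The latter accuracy is dictated by the start: outside probability `0.05` a uniform point has `|⟪v₁,
a₀⟫| ≥ 1 / (200 √d)` (`sphereUniform_slab_le`), so its tangent is at most `R = 200 √d`. With such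
errors each step contracts the tangent by `1 - 1 / (2κ)` until the target is reached
(`Problem.Aligned.step`, `Problem.aligned_iterate`), so order `κ log (d/ε)` steps suffice.

The loss in reward is quadratic in the tangent, at most `λ₁ ε²`. Explore-then-commit balances `T λ₁
ε²` against the exploration cost, which is `λ₁ κ d² / (Δ² ε²)` up to logarithms. -/

noncomputable section

namespace BanditEig

open scoped RealInnerProductSpace ENNReal

/-! ### Isotropic Gaussian vectors and their truncation to the unit ball -/

/-- The isotropic Gaussian law `N(0, (1/m) I_d)`. -/
abbrev isoGauss (d : ℕ) (m : ℝ) : Measure (E d) :=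
  multivariateGaussian (0 : E d) ((1 / m) • (1 : Matrix (Fin d) (Fin d) ℝ))

/-- The isotropic Gaussian law conditioned on the closed unit ball. -/
def truncGauss (d : ℕ) (m : ℝ) : Measure (E d) :=
  cond (isoGauss d m) (Metric.closedBall 0 1)

lemma posSemidef_inv_smul_one (d : ℕ) {m : ℝ} (hm : 0 ≤ m) :
    ((1 / m) • (1 : Matrix (Fin d) (Fin d) ℝ)).PosSemidef :=
  Matrix.PosSemidef.one.smul (by positivity)

lemma charFun_isoGauss {d : ℕ} {m : ℝ} (hm : 0 ≤ m) (x : E d) :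
    charFun (isoGauss d m) x = Complex.exp (-(((1 / m) * ‖x‖ ^ 2 : ℝ) : ℂ) / 2) := by
  rw [charFun_multivariateGaussian (posSemidef_inv_smul_one d hm)]
  congr 1
  rw [EuclideanSpace.real_norm_sq_eq]
  simp [Matrix.smul_mulVec, dotProduct, neg_div, pow_two, Finset.mul_sum, mul_left_comm]

/-- The characteristic function depends on the norm of its argument only. -/
lemma map_isoGauss {d : ℕ} {m : ℝ} (hm : 0 ≤ m) (φ : E d ≃ₗᵢ[ℝ] E d) :
    (isoGauss d m).map φ = isoGauss d m := by
  have : IsFiniteMeasure ((isoGauss d m).map φ) := by infer_instance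
  apply Measure.ext_of_charFun
  ext t
  have h : charFun ((isoGauss d m).map φ) t = charFun (isoGauss d m) (φ.symm t) := by
    rw [charFun_apply, charFun_apply, integral_map (by fun_prop) (by fun_prop)]
    congr 1 with x
    rw [← φ.inner_map_map x (φ.symm t), φ.apply_symm_apply]
  rw [h, charFun_isoGauss hm, charFun_isoGauss hm, φ.symm.norm_map]

lemma map_inner_isoGauss {d : ℕ} {m : ℝ} (hm : 0 ≤ m) {u : E d} (hu : ‖u‖ = 1) :
    (isoGauss d m).map (fun z => ⟪u, z⟫) = gaussianReal 0 (1 / m).toNNReal := by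
  have : IsFiniteMeasure ((isoGauss d m).map (fun z => ⟪u, z⟫)) := by infer_instance
  apply Measure.ext_of_charFun
  ext t
  have h : charFun ((isoGauss d m).map (fun z => ⟪u, z⟫)) t = charFun (isoGauss d m) (t • u) := by
    rw [charFun_apply, charFun_apply, integral_map (by fun_prop) (by fun_prop)]
    congr 1 with x
    simp [inner_smul_right, real_inner_comm]
  rw [h, charFun_isoGauss hm, charFun_gaussianReal, norm_smul, hu]
  congr 1
  simp [Real.coe_toNNReal _ (inv_nonneg.2 hm)]
  ring

/-- The weight turns the density into a multiple of `exp (-3x²/8)`; the integral equals `√(4/3)`. -/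
lemma lintegral_exp_sq_gaussianReal :
    ∫⁻ x, ENNReal.ofReal (Real.exp (x ^ 2 / 8)) ∂(gaussianReal 0 1) ≤ 2 := by
  have h1 : ∫⁻ x, ENNReal.ofReal (Real.exp (x ^ 2 / 8)) ∂(gaussianReal 0 1) =
      ∫⁻ x, ENNReal.ofReal ((√(2 * Real.pi))⁻¹ * Real.exp (-(3 / 8) * x ^ 2)) := by
    rw [gaussianReal_of_var_ne_zero _ one_ne_zero, lintegral_withDensity_eq_lintegral_mul _
      (measurable_gaussianPDF _ _) (by fun_prop)]
    congr 1 with x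
    simp only [Pi.mul_apply, gaussianPDF, gaussianPDFReal]
    rw [← ENNReal.ofReal_mul (by positivity), mul_assoc, ← Real.exp_add]
    congr 2
    · simp
    · congr 1; simp; ring
  have hi : Integrable (fun x : ℝ => (√(2 * Real.pi))⁻¹ * Real.exp (-(3 / 8) * x ^ 2)) :=
    (integrable_exp_neg_mul_sq (by norm_num)).const_mul _
  rw [h1, ← ofReal_integral_eq_lintegral_ofReal hi (ae_of_all _ fun x => by positivity),
    integral_const_mul, integral_gaussian, ← Real.sqrt_inv, ← Real.sqrt_mul (by positivity)]
  rw [show (2 : ℝ≥0∞) = ENNReal.ofReal 2 by simp]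
  apply ENNReal.ofReal_le_ofReal
  rw [Real.sqrt_le_iff]
  refine ⟨by norm_num, ?_⟩
  have : Real.pi ≠ 0 := Real.pi_ne_zero
  field_simp
  norm_num

lemma lintegral_exp_inner_sq_isoGauss {d : ℕ} {m : ℝ} (hm : 0 < m) {u : E d} (hu : ‖u‖ = 1) :
    ∫⁻ z, ENNReal.ofReal (Real.exp (m * ⟪u, z⟫ ^ 2 / 8)) ∂(isoGauss d m) ≤ 2 := by
  have h1 : gaussianReal 0 1 = (gaussianReal 0 (1 / m).toNNReal).map (√m * ·) := by
    rw [gaussianReal_map_const_mul, mul_zero]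
    congr 1
    ext
    simp [Real.coe_toNNReal _ (inv_nonneg.2 hm.le), Real.sq_sqrt hm.le, hm.ne']
  have h2 := lintegral_exp_sq_gaussianReal
  rw [h1, ← map_inner_isoGauss hm.le hu, lintegral_map (by fun_prop) (by fun_prop),
    lintegral_map (by fun_prop) (by fun_prop)] at h2
  simpa [mul_pow, Real.sq_sqrt hm.le] using h2

lemma integrable_exp_inner_sq_isoGauss {d : ℕ} {m : ℝ} (hm : 0 < m) {u : E d} (hu : ‖u‖ = 1) :
    Integrable (fun z => Real.exp (m * ⟪u, z⟫ ^ 2 / 8)) (isoGauss d m) := by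
  refine ⟨by fun_prop, ?_⟩
  rw [hasFiniteIntegral_iff_ofReal (ae_of_all _ fun _ => (Real.exp_pos _).le)]
  exact (lintegral_exp_inner_sq_isoGauss hm hu).trans_lt (by simp)

lemma integral_exp_inner_sq_isoGauss_le {d : ℕ} {m : ℝ} (hm : 0 < m) {u : E d} (hu : ‖u‖ = 1) :
    ∫ z, Real.exp (m * ⟪u, z⟫ ^ 2 / 8) ∂(isoGauss d m) ≤ 2 := by
  rw [integral_eq_lintegral_of_nonneg_ae (ae_of_all _ fun _ => (Real.exp_pos _).le) (by fun_prop)]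
  exact ENNReal.toReal_le_of_le_ofReal (by norm_num)
    (by simpa using lintegral_exp_inner_sq_isoGauss hm hu)

lemma integral_inner_sq_isoGauss {d : ℕ} {m : ℝ} (hm : 0 < m) {u : E d} (hu : ‖u‖ = 1) :
    ∫ z, ⟪u, z⟫ ^ 2 ∂(isoGauss d m) = 1 / m := by
  have h := variance_fun_id_gaussianReal (μ := 0) (v := (1 / m).toNNReal)
  rw [variance_eq_integral (by fun_prop), integral_id_gaussianReal] at h
  rw [← map_inner_isoGauss hm.le hu, integral_map (by fun_prop) (by fun_prop)] at h
  simpa [Real.coe_toNNReal _ (inv_nonneg.2 hm.le)] using h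

lemma integrable_inner_pow_isoGauss {d : ℕ} {m : ℝ} (hm : 0 < m) {u : E d} (hu : ‖u‖ = 1)
    (k : ℕ) : Integrable (fun z => ⟪u, z⟫ ^ k) (isoGauss d m) := by
  have h : MemLp id k (gaussianReal 0 (1 / m).toNNReal) := memLp_id_gaussianReal _
  have h2 := h.integrable_norm_pow'
  rw [← map_inner_isoGauss hm.le hu, integrable_map_measure (by fun_prop) (by fun_prop)] at h2
  refine h2.mono (by fun_prop) (ae_of_all _ fun z => ?_)
  simp

/-- The quadratic Taylor term of `exp t` at `t = x² / 8` is `x⁴ / 128`. -/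
lemma pow_four_le_exp (x : ℝ) : x ^ 4 ≤ 128 * Real.exp (x ^ 2 / 8) := by
  have h := Real.quadratic_le_exp_of_nonneg (show 0 ≤ x ^ 2 / 8 by positivity)
  nlinarith [sq_nonneg x]

lemma integral_inner_pow_four_isoGauss_le {d : ℕ} {m : ℝ} (hm : 0 < m) {u : E d} (hu : ‖u‖ = 1) :
    ∫ z, ⟪u, z⟫ ^ 4 ∂(isoGauss d m) ≤ 256 / m ^ 2 := by
  have h : ∫ z, ⟪u, z⟫ ^ 4 ∂(isoGauss d m) ≤
      ∫ z, 128 / m ^ 2 * Real.exp (m * ⟪u, z⟫ ^ 2 / 8) ∂(isoGauss d m) := by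
    refine integral_mono (integrable_inner_pow_isoGauss hm hu 4)
      ((integrable_exp_inner_sq_isoGauss hm hu).const_mul _) fun z => ?_
    have := pow_four_le_exp (√m * ⟪u, z⟫)
    rw [mul_pow, mul_pow, Real.sq_sqrt hm.le, show √m ^ 4 = (√m ^ 2) ^ 2 by ring,
      Real.sq_sqrt hm.le] at this
    simp only
    rw [div_mul_eq_mul_div, le_div_iff₀ (by positivity)]
    linarith
  rw [integral_const_mul] at h
  refine h.trans ?_
  calc 128 / m ^ 2 * ∫ z, Real.exp (m * ⟪u, z⟫ ^ 2 / 8) ∂(isoGauss d m)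
      ≤ 128 / m ^ 2 * 2 := by gcongr; exact integral_exp_inner_sq_isoGauss_le hm hu
    _ = _ := by ring

lemma integral_norm_sq_isoGauss {d : ℕ} {m : ℝ} (hm : 0 < m) :
    ∫ z, ‖z‖ ^ 2 ∂(isoGauss d m) = d / m := by
  have h (z : E d) : ‖z‖ ^ 2 = ∑ j, ⟪EuclideanSpace.basisFun (Fin d) ℝ j, z⟫ ^ 2 :=
    ((EuclideanSpace.basisFun (Fin d) ℝ).sum_sq_inner_right z).symm
  simp_rw [h]
  rw [integral_finsetSum _ fun j _ => integrable_inner_pow_isoGauss hm (by simp) 2]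
  simp_rw [fun j => integral_inner_sq_isoGauss (d := d) hm
    (OrthonormalBasis.norm_eq_one (EuclideanSpace.basisFun (Fin d) ℝ) j)]
  simp [div_eq_mul_inv]

lemma integrable_norm_sq_isoGauss {d : ℕ} {m : ℝ} :
    Integrable (fun z => ‖z‖ ^ 2) (isoGauss d m) :=
  (IsGaussian.memLp_two_id (μ := isoGauss d m)).integrable_norm_pow (by norm_num)

/-- Markov's inequality for `‖z‖²`, whose mean is `d / m ≤ 1/2`. Conditioning on the ball therefore
at most doubles integrals of nonnegative functions. -/
lemma half_le_isoGauss_ball {d : ℕ} {m : ℝ} (hm : 0 < m) (hdm : 2 * d ≤ m) :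
    1 / 2 ≤ (isoGauss d m).real (Metric.closedBall 0 1) := by
  have h := mul_meas_ge_le_integral_of_nonneg (μ := isoGauss d m) (f := fun z => ‖z‖ ^ 2)
    (ae_of_all _ fun _ => by positivity) integrable_norm_sq_isoGauss 1
  rw [integral_norm_sq_isoGauss hm, one_mul] at h
  have h2 : (d : ℝ) / m ≤ 1 / 2 := by
    rw [div_le_div_iff₀ hm two_pos]; linarith
  have h3 := measureReal_compl (μ := isoGauss d m)
    (Metric.isClosed_closedBall (x := (0 : E d)) (ε := 1)).measurableSet
  have h4 : (isoGauss d m).real (Metric.closedBall 0 1)ᶜ ≤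
      (isoGauss d m).real {z | 1 ≤ ‖z‖ ^ 2} := by
    refine measureReal_mono (fun z hz => ?_) (measure_ne_top _ _)
    simp only [Set.mem_compl_iff, Metric.mem_closedBall, dist_zero_right, not_le] at hz
    change 1 ≤ ‖z‖ ^ 2
    nlinarith
  simp only [probReal_univ] at h3
  linarith

/-! ### The Gaussian conditioned on the unit ball: symmetry and second moments -/

section TruncGauss

variable {d : ℕ} {m : ℝ}

lemma isoGauss_ball_ne_zero (hm : 0 < m) (hdm : 2 * d ≤ m) :
    isoGauss d m (Metric.closedBall 0 1) ≠ 0 := by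
  intro h
  have := half_le_isoGauss_ball hm hdm
  rw [measureReal_def, h] at this
  norm_num at this

lemma isProbabilityMeasure_truncGauss (hm : 0 < m) (hdm : 2 * d ≤ m) :
    IsProbabilityMeasure (truncGauss d m) :=
  cond_isProbabilityMeasure (isoGauss_ball_ne_zero hm hdm)

lemma ae_norm_le_one_truncGauss : ∀ᵐ z ∂(truncGauss d m), ‖z‖ ≤ 1 := by
  have := ae_cond_mem (μ := isoGauss d m)
    (Metric.isClosed_closedBall (x := (0 : E d)) (ε := 1)).measurableSet
  filter_upwards [this] with z hz
  simpa using hz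

lemma lintegral_truncGauss_le (hm : 0 < m) (hdm : 2 * d ≤ m) (g : E d → ℝ≥0∞) :
    ∫⁻ z, g z ∂(truncGauss d m) ≤ 2 * ∫⁻ z, g z ∂(isoGauss d m) := by
  rw [truncGauss, ProbabilityTheory.cond, lintegral_smul_measure, smul_eq_mul]
  refine mul_le_mul' ?_ (lintegral_mono' Measure.restrict_le_self le_rfl)
  have h := half_le_isoGauss_ball hm hdm
  rw [ENNReal.inv_le_iff_inv_le]
  rw [measureReal_def] at h
  rw [← ENNReal.ofReal_toReal (measure_ne_top (isoGauss d m) (Metric.closedBall 0 1))]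
  refine le_trans ?_ (ENNReal.ofReal_le_ofReal h)
  rw [one_div, ENNReal.ofReal_inv_of_pos two_pos]
  simp

lemma integrable_truncGauss {g : E d → ℝ} (hg : Integrable g (isoGauss d m)) :
    Integrable g (truncGauss d m) := by
  by_cases h : isoGauss d m (Metric.closedBall 0 1) = 0
  · rw [truncGauss, cond_eq_zero_of_meas_eq_zero h]
    exact integrable_zero_measure
  · rw [truncGauss, ProbabilityTheory.cond]
    exact hg.restrict.smul_measure (by simpa using h)

lemma integral_truncGauss_le (hm : 0 < m) (hdm : 2 * d ≤ m) {g : E d → ℝ} (h0 : 0 ≤ g)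
    (hg : Integrable g (isoGauss d m)) :
    ∫ z, g z ∂(truncGauss d m) ≤ 2 * ∫ z, g z ∂(isoGauss d m) := by
  rw [integral_eq_lintegral_of_nonneg_ae (ae_of_all _ h0)
    (integrable_truncGauss hg).aestronglyMeasurable,
    integral_eq_lintegral_of_nonneg_ae (ae_of_all _ h0) hg.aestronglyMeasurable]
  have h := lintegral_truncGauss_le hm hdm fun z => ENNReal.ofReal (g z)
  have h2 : ∫⁻ z, ENNReal.ofReal (g z) ∂(isoGauss d m) ≠ ∞ :=
    ((hasFiniteIntegral_iff_ofReal (ae_of_all _ h0)).1 hg.2).ne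
  have h3 := ENNReal.toReal_mono (ENNReal.mul_ne_top (by simp) h2) h
  simpa using h3

lemma map_truncGauss (hm : 0 ≤ m) (φ : E d ≃ₗᵢ[ℝ] E d) :
    (truncGauss d m).map φ = truncGauss d m := by
  have hpre : φ ⁻¹' Metric.closedBall 0 1 = Metric.closedBall 0 1 := by
    ext z; simp
  have hB : MeasurableSet (Metric.closedBall (0 : E d) 1) := Metric.isClosed_closedBall.measurableSet
  rw [truncGauss, ProbabilityTheory.cond, Measure.map_smul]
  congr 1
  conv_lhs => rw [← hpre]
  rw [← Measure.restrict_map (by fun_prop) hB, map_isoGauss hm]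

lemma integral_comp_truncGauss (hm : 0 ≤ m) (φ : E d ≃ₗᵢ[ℝ] E d) (g : E d → ℝ) :
    ∫ z, g (φ z) ∂(truncGauss d m) = ∫ z, g z ∂(truncGauss d m) := by
  conv_rhs => rw [← map_truncGauss hm φ]
  exact (φ.toHomeomorph.measurableEmbedding.integral_map g).symm

lemma integrable_inner_pow_truncGauss (hm : 0 < m) {u : E d} (hu : ‖u‖ = 1) (k : ℕ) :
    Integrable (fun z => ⟪u, z⟫ ^ k) (truncGauss d m) :=
  integrable_truncGauss (integrable_inner_pow_isoGauss hm hu k)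

/-- Vectors of equal norm are exchanged by a reflection, which preserves the law. -/
lemma integral_inner_sq_truncGauss_congr (hm : 0 ≤ m) {u v : E d} (h : ‖u‖ = ‖v‖) :
    ∫ z, ⟪u, z⟫ ^ 2 ∂(truncGauss d m) = ∫ z, ⟪v, z⟫ ^ 2 ∂(truncGauss d m) := by
  set φ := (ℝ ∙ (u - v))ᗮ.reflection
  have hφ : φ u = v := Submodule.reflection_sub h
  rw [← integral_comp_truncGauss hm φ fun z => ⟪v, z⟫ ^ 2]
  congr 1 with z
  rw [← hφ, φ.inner_map_map]

lemma integrable_inner_mul_inner_truncGauss (w u : E d) :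
    Integrable (fun z => ⟪w, z⟫ * ⟪u, z⟫) (truncGauss d m) := by
  apply integrable_truncGauss
  refine (integrable_norm_sq_isoGauss.const_mul (‖w‖ * ‖u‖)).mono (by fun_prop)
    (ae_of_all _ fun z => ?_)
  rw [norm_mul, Real.norm_eq_abs, Real.norm_eq_abs, Real.norm_of_nonneg (by positivity)]
  calc |⟪w, z⟫| * |⟪u, z⟫| ≤ (‖w‖ * ‖z‖) * (‖u‖ * ‖z‖) := by
        gcongr <;> exact abs_real_inner_le_norm _ _
    _ = _ := by ring

/-- Truncation removes at most half of the second moment `1 / m`: outside the ball `⟪u, z⟫² ≤ ⟪u,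
z⟫² ‖z‖²`, which is quartic and has mean at most `256 d / m² ≤ 1 / (2m)`. -/
lemma integral_inner_sq_truncGauss_ge (hm : 0 < m) (hdm : 512 * d ≤ m) {u : E d} (hu : ‖u‖ = 1) :
    1 / (2 * m) ≤ ∫ z, ⟪u, z⟫ ^ 2 ∂(truncGauss d m) := by
  have hdm2 : 2 * (d : ℝ) ≤ m := by linarith [Nat.cast_nonneg (α := ℝ) d]
  set b := EuclideanSpace.basisFun (Fin d) ℝ
  set B := Metric.closedBall (0 : E d) 1
  have hB : MeasurableSet B := Metric.isClosed_closedBall.measurableSet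
  have hi := integrable_inner_pow_isoGauss (d := d) hm hu
  have hj (j : Fin d) := integrable_inner_pow_isoGauss (d := d) hm (b.norm_eq_one j)
  have h1 : ∫ z in Bᶜ, ⟪u, z⟫ ^ 2 ∂(isoGauss d m) ≤ 256 * d / m ^ 2 := by
    calc ∫ z in Bᶜ, ⟪u, z⟫ ^ 2 ∂(isoGauss d m)
        ≤ ∫ z in Bᶜ, ∑ j, (⟪u, z⟫ ^ 4 + ⟪b j, z⟫ ^ 4) / 2 ∂(isoGauss d m) := by
          refine setIntegral_mono_on (hi 2).integrableOn
            (integrable_finsetSum _ fun j _ => ((hi 4).add (hj j 4)).div_const 2).integrableOn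
            hB.compl fun z hz => ?_
          have hz1 : 1 ≤ ‖z‖ := by
            simp only [B, Set.mem_compl_iff, Metric.mem_closedBall, dist_zero_right, not_le] at hz
            exact hz.le
          calc ⟪u, z⟫ ^ 2 ≤ ⟪u, z⟫ ^ 2 * ‖z‖ ^ 2 :=
                le_mul_of_one_le_right (sq_nonneg _) (one_le_pow₀ hz1)
            _ = ∑ j, ⟪u, z⟫ ^ 2 * ⟪b j, z⟫ ^ 2 := by
                rw [← b.sum_sq_inner_right z, Finset.mul_sum]
            _ ≤ _ := Finset.sum_le_sum fun j _ => by
                nlinarith [sq_nonneg (⟪u, z⟫ ^ 2 - ⟪b j, z⟫ ^ 2)]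
      _ ≤ ∫ z, ∑ j, (⟪u, z⟫ ^ 4 + ⟪b j, z⟫ ^ 4) / 2 ∂(isoGauss d m) :=
          setIntegral_le_integral
            (integrable_finsetSum _ fun j _ => ((hi 4).add (hj j 4)).div_const 2)
            (ae_of_all _ fun z => Finset.sum_nonneg fun j _ => by positivity)
      _ = ∑ j, (∫ z, ⟪u, z⟫ ^ 4 ∂(isoGauss d m) + ∫ z, ⟪b j, z⟫ ^ 4 ∂(isoGauss d m)) / 2 := by
          have hij (j : Fin d) : Integrable (fun z => (⟪u, z⟫ ^ 4 + ⟪b j, z⟫ ^ 4) / 2)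
            (isoGauss d m) := ((hi 4).add (hj j 4)).div_const 2
          rw [integral_finsetSum _ fun j _ => hij j]
          refine Finset.sum_congr rfl fun j _ => ?_
          rw [integral_div, integral_add (hi 4) (hj j 4)]
      _ ≤ ∑ _j : Fin d, 256 / m ^ 2 := Finset.sum_le_sum fun j _ => by
          linarith [integral_inner_pow_four_isoGauss_le (d := d) hm hu,
            integral_inner_pow_four_isoGauss_le (d := d) hm (b.norm_eq_one j)]
      _ = _ := by simp; ring
  have h2 := integral_add_compl hB (hi 2)
  rw [integral_inner_sq_isoGauss hm hu] at h2
  -- Normalizing divides by a mass of at most one, which can only help.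
  have h3 : ∫ z in B, ⟪u, z⟫ ^ 2 ∂(isoGauss d m) ≤ ∫ z, ⟪u, z⟫ ^ 2 ∂(truncGauss d m) := by
    rw [truncGauss, ProbabilityTheory.cond, integral_smul_measure]
    refine le_mul_of_one_le_left (integral_nonneg fun _ => sq_nonneg _) ?_
    rw [ENNReal.toReal_inv]
    refine (one_le_inv₀ (ENNReal.toReal_pos (isoGauss_ball_ne_zero hm hdm2)
      (measure_ne_top _ _))).2 ?_
    exact measureReal_le_one
  have h4 : 256 * d / m ^ 2 ≤ 1 / (2 * m) := by
    rw [div_le_div_iff₀ (by positivity) (by positivity)]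
    nlinarith
  have h5 : 1 / m = 1 / (2 * m) + 1 / (2 * m) := by field_simp; norm_num
  linarith

/-- By rotational invariance the second moments of the truncated Gaussian are isotropic. -/
lemma exists_secondMoment_truncGauss (hm : 0 < m) (hdm : 512 * d ≤ m) {e : E d} (he : ‖e‖ = 1) :
    ∃ c : ℝ, 1 / 2 ≤ c ∧
      ∀ w u : E d, ∫ z, ⟪w, z⟫ * ⟪u, z⟫ ∂(truncGauss d m) = c / m * ⟪w, u⟫ := by
  set q := ∫ z, ⟪e, z⟫ ^ 2 ∂(truncGauss d m) with hq
  have hsq (u : E d) : ∫ z, ⟪u, z⟫ ^ 2 ∂(truncGauss d m) = q * ‖u‖ ^ 2 := by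
    rw [integral_inner_sq_truncGauss_congr hm.le (u := u) (v := ‖u‖ • e)
      (by rw [norm_smul, he, norm_norm, mul_one])]
    simp_rw [real_inner_smul_left, mul_pow]
    rw [integral_const_mul, mul_comm]
  refine ⟨m * q, ?_, fun w u => ?_⟩
  · have h := mul_le_mul_of_nonneg_left (integral_inner_sq_truncGauss_ge hm hdm he) hm.le
    refine le_trans (le_of_eq ?_) h
    field_simp
  · have hi (w u : E d) := integrable_inner_mul_inner_truncGauss (m := m) w u
    -- Polarization reduces mixed moments to the common second moment `q`.
    have h1 (z : E d) : ⟪w, z⟫ * ⟪u, z⟫ = (⟪w + u, z⟫ ^ 2 - ⟪w - u, z⟫ ^ 2) / 4 := by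
      rw [inner_add_left, inner_sub_left]; ring
    have h2 (v : E d) : Integrable (fun z => ⟪v, z⟫ ^ 2) (truncGauss d m) := by
      simpa [pow_two] using hi v v
    simp_rw [h1]
    rw [integral_div, integral_sub (h2 _) (h2 _), hsq, hsq,
      mul_div_cancel_left₀ _ hm.ne', @norm_add_sq_real, @norm_sub_sq_real]
    ring

lemma integral_odd_truncGauss (hm : 0 ≤ m) {g : E d → ℝ} (hg : ∀ z, g (-z) = -g z) :
    ∫ z, g z ∂(truncGauss d m) = 0 := by
  have h := integral_comp_truncGauss hm (LinearIsometryEquiv.neg ℝ) g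
  simp only [LinearIsometryEquiv.coe_neg, hg, integral_neg] at h
  linarith

end TruncGauss

/-! ### Moment generating function of a single sample -/

lemma exp_le_one_add_sq_mul_exp_abs (x : ℝ) : Real.exp x ≤ 1 + x + x ^ 2 * Real.exp |x| := by
  have h1 : |Real.exp x - 1 - x| ≤ x ^ 2 * Real.exp |x| := by
    have h := Complex.norm_exp_sub_sum_le_norm_mul_exp (x : ℂ) 2
    simp only [Finset.sum_range_succ, Finset.sum_range_zero] at h
    rw [← Complex.ofReal_exp] at h
    simp at h
    rw [← sub_sub] at h
    exact_mod_cast h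
  linarith [le_abs_self (Real.exp x - 1 - x)]

/-- The hypothesis gives `|x| ≤ |σ| V` with `V` affine in `g²`. Both `V²` and `exp |x|` are absorbed
by `exp (V / 8)`, and the total exponent `V / 4` grows like `5 g² / 64`, below the available `g² /
8`. -/
lemma sq_mul_exp_abs_le {x σ g : ℝ} (hσ : |σ| ≤ 1 / 8) (hx : |x| ≤ |σ| * |g| + σ ^ 2 * g ^ 2 / 2) :
    x ^ 2 * Real.exp |x| ≤ 256 * σ ^ 2 * Real.exp (g ^ 2 / 8) := by
  set V := 1 + 5 * g ^ 2 / 16 with hV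
  have hV0 : 0 ≤ V := by positivity
  have hg : |g| ≤ 1 + g ^ 2 / 4 := by
    rw [← sq_abs g]; nlinarith [sq_nonneg (|g| - 2)]
  have hxV : |x| ≤ |σ| * V := by
    have : σ ^ 2 * g ^ 2 / 2 ≤ |σ| * (g ^ 2 / 16) := by
      rw [← sq_abs σ]; nlinarith [abs_nonneg σ, mul_nonneg (abs_nonneg σ) (sq_nonneg g)]
    nlinarith [abs_nonneg σ]
  have hx2 : x ^ 2 ≤ σ ^ 2 * V ^ 2 := by
    rw [← sq_abs x, ← sq_abs σ, ← mul_pow]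
    gcongr
  have hxe : Real.exp |x| ≤ Real.exp (V / 8) := by
    apply Real.exp_le_exp.2
    nlinarith
  have hVe : V ^ 2 ≤ 128 * Real.exp (V / 8) := by
    have h := Real.quadratic_le_exp_of_nonneg (show 0 ≤ V / 8 by positivity)
    nlinarith
  have h14 : Real.exp (1 / 4) ≤ 2 := by
    have := Real.exp_one_lt_d9
    rw [show (1 : ℝ) / 4 = 1 * (4⁻¹) by norm_num, Real.exp_mul]
    calc Real.exp 1 ^ (4⁻¹ : ℝ) ≤ (16 : ℝ) ^ (4⁻¹ : ℝ) := by gcongr; linarith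
      _ = 2 := by rw [show (16 : ℝ) = 2 ^ (4 : ℝ) by norm_num, ← Real.rpow_mul (by norm_num)]; norm_num
  calc x ^ 2 * Real.exp |x| ≤ (σ ^ 2 * (128 * Real.exp (V / 8))) * Real.exp (V / 8) := by
        gcongr
        exact hx2.trans (by gcongr)
    _ = 128 * σ ^ 2 * (Real.exp (1 / 4) * Real.exp (5 * g ^ 2 / 64)) := by
        rw [← Real.exp_add, mul_assoc, mul_assoc, ← Real.exp_add, hV]; ring_nf
    _ ≤ 128 * σ ^ 2 * (2 * Real.exp (g ^ 2 / 8)) := by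
        refine mul_le_mul_of_nonneg_left (mul_le_mul h14 ?_ (Real.exp_pos _).le two_pos.le)
          (by positivity)
        exact Real.exp_le_exp.2 (by linarith [sq_nonneg g])
    _ = _ := by ring

/-- Moment generating function bound for the product of a bounded reward, which is an even function
plus a linear one, with a coordinate of a truncated Gaussian vector, with room for unit
sub-Gaussian noise. -/
lemma lintegral_exp_truncGauss_le {d : ℕ} {m : ℝ} (hm : 0 < m) (hdm : 2 * d ≤ m) {c : ℝ}
    (hc : ∀ w u : E d, ∫ z, ⟪w, z⟫ * ⟪u, z⟫ ∂(truncGauss d m) = c / m * ⟪w, u⟫)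
    {F h : E d → ℝ} {b : E d} (hF : Measurable F) (hFb : ∀ z, ‖z‖ ≤ 1 → |F z| ≤ 1)
    (hFh : ∀ z, F z = h z + ⟪b, z⟫) (hh : ∀ z, h (-z) = h z)
    {u : E d} (hu : ‖u‖ = 1) {s : ℝ} (hs : |s| ≤ √m / 8) :
    ∫⁻ z, ENNReal.ofReal (Real.exp (s * (F z * ⟪u, z⟫) + s ^ 2 * ⟪u, z⟫ ^ 2 / 2))
      ∂(truncGauss d m) ≤
      ENNReal.ofReal (Real.exp (s * (c / m * ⟪b, u⟫) + 1025 * s ^ 2 / m)) := by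
  have := isProbabilityMeasure_truncGauss hm hdm
  set ν := truncGauss d m
  have hw : Integrable (fun z => ⟪u, z⟫) ν := by
    simpa using integrable_inner_pow_truncGauss hm hu 1
  have hw2 := integrable_inner_pow_truncGauss hm hu 2
  have hFw : Integrable (fun z => F z * ⟪u, z⟫) ν := by
    refine hw.mono (by fun_prop) ?_
    filter_upwards [ae_norm_le_one_truncGauss] with z hz
    rw [norm_mul]
    exact mul_le_of_le_one_left (norm_nonneg _) (hFb z hz)
  have hbw := integrable_inner_mul_inner_truncGauss (m := m) b u
  -- The even part of `F` times `⟪u, z⟫` is odd and integrates to zero, so only the linear part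
  -- contributes.
  have hE : ∫ z, F z * ⟪u, z⟫ ∂ν = c / m * ⟪b, u⟫ := by
    have h1 : ∫ z, (F z * ⟪u, z⟫ - ⟪b, z⟫ * ⟪u, z⟫) ∂ν = 0 :=
      integral_odd_truncGauss hm.le fun z => by
        rw [hFh, hFh, hh]; simp only [inner_neg_right]; ring
    rw [integral_sub hFw hbw, hc] at h1
    linarith
  have hexp := integrable_truncGauss (integrable_exp_inner_sq_isoGauss hm hu)
  have hexp_le : ∫ z, Real.exp (m * ⟪u, z⟫ ^ 2 / 8) ∂ν ≤ 4 := by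
    have h1 := integral_truncGauss_le hm hdm (fun _ => (Real.exp_pos _).le)
      (integrable_exp_inner_sq_isoGauss hm hu)
    have h2 := integral_exp_inner_sq_isoGauss_le hm hu
    linarith
  have hw2_le : ∫ z, ⟪u, z⟫ ^ 2 ∂ν ≤ 2 / m := by
    have h1 := integral_truncGauss_le hm hdm (fun z => sq_nonneg ⟪u, z⟫)
      (integrable_inner_pow_isoGauss hm hu 2)
    rw [integral_inner_sq_isoGauss hm hu] at h1
    rwa [mul_one_div] at h1
  -- The first-order term is kept exactly, since its mean must appear in the exponent with constant
  -- one; only the remainder is estimated, with `σ = s / √m` and `g = √m ⟪u, z⟫`.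
  have hpt : ∀ᵐ z ∂ν, Real.exp (s * (F z * ⟪u, z⟫) + s ^ 2 * ⟪u, z⟫ ^ 2 / 2) ≤
      1 + s * (F z * ⟪u, z⟫) + s ^ 2 / 2 * ⟪u, z⟫ ^ 2 +
        256 * (s ^ 2 / m) * Real.exp (m * ⟪u, z⟫ ^ 2 / 8) := by
    filter_upwards [ae_norm_le_one_truncGauss] with z hz
    have h1 := exp_le_one_add_sq_mul_exp_abs (s * (F z * ⟪u, z⟫) + s ^ 2 * ⟪u, z⟫ ^ 2 / 2)
    have hsm : √m ≠ 0 := (Real.sqrt_pos.2 hm).ne'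
    have hmm : √m ^ 2 = m := Real.sq_sqrt hm.le
    have h2 := sq_mul_exp_abs_le (x := s * (F z * ⟪u, z⟫) + s ^ 2 * ⟪u, z⟫ ^ 2 / 2) (σ := s / √m)
      (g := √m * ⟪u, z⟫) (by
        rw [abs_div, abs_of_pos (Real.sqrt_pos.2 hm), div_le_iff₀ (Real.sqrt_pos.2 hm)]
        linarith) (by
        have e1 : s / √m * (√m * ⟪u, z⟫) = s * ⟪u, z⟫ := by field_simp
        have e2 : (s / √m) ^ 2 * (√m * ⟪u, z⟫) ^ 2 = s ^ 2 * ⟪u, z⟫ ^ 2 := by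
          rw [← mul_pow, e1, mul_pow]
        rw [← abs_mul, e1, e2]
        refine (abs_add_le _ _).trans ?_
        rw [abs_of_nonneg (show 0 ≤ s ^ 2 * ⟪u, z⟫ ^ 2 / 2 by positivity)]
        refine add_le_add_left ?_ _
        rw [abs_mul, abs_mul, abs_mul]
        gcongr
        exact mul_le_of_le_one_left (abs_nonneg _) (hFb z hz))
    rw [div_pow, mul_pow, hmm] at h2
    linarith
  have hint2 : Integrable (fun z => 1 + s * (F z * ⟪u, z⟫)) ν :=
    (integrable_const 1).add (hFw.const_mul s)
  have hint3 : Integrable (fun z => 1 + s * (F z * ⟪u, z⟫) + s ^ 2 / 2 * ⟪u, z⟫ ^ 2) ν :=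
    hint2.add (hw2.const_mul _)
  have hint : Integrable (fun z => 1 + s * (F z * ⟪u, z⟫) + s ^ 2 / 2 * ⟪u, z⟫ ^ 2 +
        256 * (s ^ 2 / m) * Real.exp (m * ⟪u, z⟫ ^ 2 / 8)) ν :=
    hint3.add (hexp.const_mul _)
  calc _ ≤ ∫⁻ z, ENNReal.ofReal (1 + s * (F z * ⟪u, z⟫) + s ^ 2 / 2 * ⟪u, z⟫ ^ 2 +
        256 * (s ^ 2 / m) * Real.exp (m * ⟪u, z⟫ ^ 2 / 8)) ∂ν := by
        refine lintegral_mono_ae ?_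
        filter_upwards [hpt] with z hz using ENNReal.ofReal_le_ofReal hz
    _ = ENNReal.ofReal (∫ z, (1 + s * (F z * ⟪u, z⟫) + s ^ 2 / 2 * ⟪u, z⟫ ^ 2 +
        256 * (s ^ 2 / m) * Real.exp (m * ⟪u, z⟫ ^ 2 / 8)) ∂ν) := by
        rw [ofReal_integral_eq_lintegral_ofReal hint]
        filter_upwards [hpt] with z hz using (Real.exp_pos _).le.trans hz
    _ ≤ _ := by
        apply ENNReal.ofReal_le_ofReal
        rw [integral_add hint3 (hexp.const_mul _), integral_add hint2 (hw2.const_mul _),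
          integral_add (integrable_const 1) (hFw.const_mul s),
          integral_const_mul, integral_const_mul, integral_const_mul, hE]
        have h1 := Real.add_one_le_exp (s * (c / m * ⟪b, u⟫) + 1025 * s ^ 2 / m)
        -- The constant is `1025 = 1 + 256 * 4`: one from the noise term, the rest from the Taylor
        -- remainder.
        have h2 : s ^ 2 / 2 * ∫ z, ⟪u, z⟫ ^ 2 ∂ν ≤ s ^ 2 / m :=
          calc _ ≤ s ^ 2 / 2 * (2 / m) := by gcongr
            _ = _ := by ring
        have h3 : 256 * (s ^ 2 / m) * ∫ z, Real.exp (m * ⟪u, z⟫ ^ 2 / 8) ∂ν ≤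
            1024 * s ^ 2 / m :=
          calc _ ≤ 256 * (s ^ 2 / m) * 4 := by gcongr
            _ = _ := by ring
        have h4 : 1025 * s ^ 2 / m = s ^ 2 / m + 1024 * s ^ 2 / m := by ring
        simp only [integral_const, probReal_univ, smul_eq_mul, mul_one]
        linarith

/-- A batch conditioned on acceptance is an independent sample from the truncated Gaussian. -/
lemma batchLaw_eq_pi (d n : ℕ) (m : ℝ) (hm : 0 < m) (hdm : 2 * d ≤ m) :
    batchLaw d n m = Measure.pi fun _ => truncGauss d m := by
  have := isProbabilityMeasure_truncGauss hm hdm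
  have hB : MeasurableSet (Metric.closedBall (0 : E d) 1) := Metric.isClosed_closedBall.measurableSet
  -- The acceptance event is a product set, so conditioning a product measure on it acts factor by
  -- factor.
  have hset : {z : Fin n → E d | ∀ i, ‖z i‖ ≤ 1} =
      Set.univ.pi fun _ => Metric.closedBall (0 : E d) 1 := by
    ext z; simp
  symm
  refine Measure.pi_eq fun s hs => ?_
  rw [batchLaw, hset, cond_apply (MeasurableSet.univ_pi fun _ => hB), ← Set.pi_inter_distrib,
    Measure.pi_pi, Measure.pi_pi]
  simp_rw [truncGauss, cond_apply hB]
  rw [Finset.prod_mul_distrib, ENNReal.prod_inv_distrib]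
  intro i _ j _ _
  exact Or.inl (isoGauss_ball_ne_zero hm hdm)

/-! ### Spectral facts and the deterministic power iteration -/

namespace Problem

variable {d : ℕ} (I : Problem d)

/-- The operator with matrix `M`. -/
def op (x : E d) : E d := ∑ j, I.lam j • ⟪I.v j, x⟫ • I.v j

lemma inner_eq_dotProduct (x y : E d) : ⟪x, y⟫ = x.ofLp ⬝ᵥ y.ofLp := by
  simp [PiLp.inner_apply, dotProduct, mul_comm]

lemma inner_op (x y : E d) : ⟪x, I.op y⟫ = ∑ j, I.lam j * (⟪I.v j, x⟫ * ⟪I.v j, y⟫) := by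
  simp only [op, inner_sum, inner_smul_right]
  refine Finset.sum_congr rfl fun j _ => ?_
  rw [real_inner_comm x]; ring

lemma f_eq_inner (a : E d) : I.f a = ⟪a, I.op a⟫ := by
  rw [inner_op, f, M, Matrix.sum_mulVec, dotProduct_sum]
  refine Finset.sum_congr rfl fun j _ => ?_
  rw [Matrix.smul_mulVec, Matrix.vecMulVec_mulVec, inner_eq_dotProduct]
  simp [dotProduct_comm]

lemma f_eq_sum (a : E d) : I.f a = ∑ j, I.lam j * ⟪I.v j, a⟫ ^ 2 := by
  rw [f_eq_inner, inner_op]; simp_rw [pow_two]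

lemma op_add (x y : E d) : I.op (x + y) = I.op x + I.op y := by
  simp [op, inner_add_right, add_smul, Finset.sum_add_distrib]

lemma inner_op_symm (x y : E d) : ⟪I.op x, y⟫ = ⟪x, I.op y⟫ := by
  rw [real_inner_comm, inner_op, inner_op]
  exact Finset.sum_congr rfl fun j _ => by ring

lemma continuous_f : Continuous I.f := by
  simp_rw [funext I.f_eq_sum]
  fun_prop

@[fun_prop]
lemma continuous_op : Continuous I.op := by
  unfold op
  fun_prop

/-- The bracket is even in `z`; the linear coefficient is the vector that correlating rewards with
`z` recovers. -/
lemma f_half_add (a z : E d) :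
    I.f ((1 / 2 : ℝ) • (a + z)) =
      (1 / 4 * I.f a + 1 / 4 * I.f z) + ⟪(1 / 2 : ℝ) • I.op a, z⟫ := by
  have h (c : ℝ) (x : E d) : I.f (c • x) = c ^ 2 * I.f x := by
    rw [f_eq_sum, f_eq_sum, Finset.mul_sum]
    refine Finset.sum_congr rfl fun j _ => ?_
    rw [inner_smul_right]; ring
  rw [h, f_eq_inner, op_add, inner_add_left, inner_add_right, inner_add_right, f_eq_inner,
    f_eq_inner, real_inner_smul_left, ← I.inner_op_symm a z, ← I.inner_op_symm z a,
    real_inner_comm _ (I.op z), I.inner_op_symm a z, ← I.inner_op_symm a z]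
  ring

lemma f_neg (z : E d) : I.f (-z) = I.f z := by
  simp [f_eq_sum]

lemma lam1_pos : 0 < I.lam1 := by
  refine lt_of_le_of_lt ?_ I.gap_pos
  split_ifs <;> positivity

lemma absLam2_nonneg : 0 ≤ I.absLam2 := by
  unfold absLam2; split_ifs <;> positivity

lemma gap_pos' : 0 < I.gap := sub_pos.2 I.gap_pos

lemma lam1_eq : I.lam1 = I.absLam2 + I.gap := by simp [gap]

lemma gap_le_lam1 : I.gap ≤ I.lam1 := by linarith [I.lam1_eq, I.absLam2_nonneg]

lemma lam1_le_one : I.lam1 ≤ 1 := I.le_one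

lemma gap_le_one : I.gap ≤ 1 := I.gap_le_lam1.trans I.lam1_le_one

lemma one_le_kappa : 1 ≤ I.kappa := (one_le_div I.gap_pos').2 I.gap_le_lam1

lemma kappa_le : I.kappa ≤ 1 / I.gap := by
  unfold kappa; gcongr
  · exact I.gap_pos'.le
  · exact I.lam1_le_one

lemma abs_lam_le (j : Fin (I.r + 1)) : |I.lam j| ≤ I.lam1 := by
  have h := I.antitone_abs (Fin.zero_le j)
  simp only at h
  rwa [abs_of_pos (show 0 < I.lam 0 from I.lam1_pos)] at h

lemma abs_lam_le_absLam2 {j : Fin (I.r + 1)} (hj : j ≠ 0) : |I.lam j| ≤ I.absLam2 := by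
  have h0 : (0 : ℕ) < j := by
    rcases Nat.eq_zero_or_pos j with h | h
    · exact absurd (Fin.ext h) hj
    · exact h
  have h : 1 < I.r + 1 := by omega
  rw [absLam2, dif_pos h]
  exact I.antitone_abs (show (⟨1, h⟩ : Fin (I.r + 1)) ≤ j from h0)

lemma norm_v1 : ‖I.v1‖ = 1 := I.orthonormal.1 0

lemma dim_pos (I : Problem d) : 0 < d := by
  have h := I.norm_v1
  refine Nat.pos_of_ne_zero fun hd => ?_
  have : Subsingleton (E d) := by subst hd; infer_instance
  rw [Subsingleton.elim I.v1 0, norm_zero] at h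
  exact zero_ne_one h

/-- The component of `x` orthogonal to `v₁`. -/
def perp (x : E d) : E d := x - ⟪I.v1, x⟫ • I.v1

lemma perp_add (x y : E d) : I.perp (x + y) = I.perp x + I.perp y := by
  simp only [perp, inner_add_right, add_smul]; abel

lemma perp_smul (c : ℝ) (x : E d) : I.perp (c • x) = c • I.perp x := by
  simp only [perp, inner_smul_right, smul_sub, mul_smul]

lemma norm_sq_eq (x : E d) : ‖x‖ ^ 2 = ⟪I.v1, x⟫ ^ 2 + ‖I.perp x‖ ^ 2 := by
  rw [perp, @norm_sub_sq_real, norm_smul, I.norm_v1, inner_smul_right, real_inner_comm,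
    Real.norm_eq_abs, mul_one, sq_abs]
  ring

lemma norm_perp_le (x : E d) : ‖I.perp x‖ ≤ ‖x‖ := by
  have := I.norm_sq_eq x
  exact (pow_le_pow_iff_left₀ (norm_nonneg _) (norm_nonneg _) two_ne_zero).1
    (by nlinarith [sq_nonneg ⟪I.v1, x⟫])

lemma inner_v_perp {j : Fin (I.r + 1)} (hj : j ≠ 0) (x : E d) :
    ⟪I.v j, I.perp x⟫ = ⟪I.v j, x⟫ := by
  rw [perp, inner_sub_right, inner_smul_right, v1, I.orthonormal.2 hj, mul_zero, sub_zero]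

lemma inner_v1_op (x : E d) : ⟪I.v1, I.op x⟫ = I.lam1 * ⟪I.v1, x⟫ := by
  rw [inner_op, Fin.sum_univ_succ]
  have h : ∀ i : Fin I.r, I.lam i.succ * (⟪I.v i.succ, I.v1⟫ * ⟪I.v i.succ, x⟫) = 0 := fun i => by
    rw [v1, I.orthonormal.2 (Fin.succ_ne_zero i)]; ring
  simp_rw [h]
  rw [show ⟪I.v 0, I.v1⟫ = 1 from by
    change ⟪I.v1, I.v1⟫ = 1
    rw [real_inner_self_eq_norm_sq, I.norm_v1, one_pow]]
  simp [lam1, v1]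

/-- Bessel's inequality for `perp x`, which has the same coefficients as `x` along the other
eigenvectors. -/
lemma bessel_succ (x : E d) : ∑ i : Fin I.r, ⟪I.v i.succ, x⟫ ^ 2 ≤ ‖I.perp x‖ ^ 2 := by
  have h := (I.orthonormal.comp _ (Fin.succ_injective _)).sum_inner_products_le
    (I.perp x) (s := Finset.univ)
  refine le_trans (le_of_eq (Finset.sum_congr rfl fun i _ => ?_)) h
  simp only [Function.comp_apply]
  rw [I.inner_v_perp (Fin.succ_ne_zero i), Real.norm_eq_abs, sq_abs]

lemma norm_perp_op_le (x : E d) : ‖I.perp (I.op x)‖ ≤ I.absLam2 * ‖I.perp x‖ := by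
  have h1 : I.perp (I.op x) = ∑ i : Fin I.r, (I.lam i.succ * ⟪I.v i.succ, x⟫) • I.v i.succ := by
    rw [perp, inner_v1_op, op, Fin.sum_univ_succ, ← smul_smul]
    simp only [lam1, v1, add_sub_cancel_left, smul_smul]
  have h2 : ‖I.perp (I.op x)‖ ^ 2 = ∑ i : Fin I.r, (I.lam i.succ * ⟪I.v i.succ, x⟫) ^ 2 := by
    have := (I.orthonormal.comp _ (Fin.succ_injective _)).inner_sum
      (fun i => I.lam i.succ * ⟪I.v i.succ, x⟫) (fun i => I.lam i.succ * ⟪I.v i.succ, x⟫)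
      Finset.univ
    rw [h1, ← real_inner_self_eq_norm_sq]
    simpa [pow_two] using this
  refine (pow_le_pow_iff_left₀ (norm_nonneg _) (mul_nonneg I.absLam2_nonneg (norm_nonneg _))
    two_ne_zero).1 ?_
  rw [h2, mul_pow]
  refine le_trans ?_ (mul_le_mul_of_nonneg_left (I.bessel_succ x) (sq_nonneg _))
  rw [Finset.mul_sum]
  refine Finset.sum_le_sum fun i _ => ?_
  rw [mul_pow]
  gcongr ?_ * _
  exact sq_le_sq' (neg_le_of_abs_le (I.abs_lam_le_absLam2 (Fin.succ_ne_zero i)))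
    (le_of_abs_le (I.abs_lam_le_absLam2 (Fin.succ_ne_zero i)))

/-- The other eigenvalues may be negative, so each is replaced by `-|λ₂|`. -/
lemma f_ge (a : E d) : I.lam1 * ⟪I.v1, a⟫ ^ 2 - I.absLam2 * ‖I.perp a‖ ^ 2 ≤ I.f a := by
  rw [f_eq_sum, Fin.sum_univ_succ]
  have h : -(I.absLam2 * ‖I.perp a‖ ^ 2) ≤ ∑ i : Fin I.r, I.lam i.succ * ⟪I.v i.succ, a⟫ ^ 2 := by
    have h1 := mul_le_mul_of_nonneg_left (I.bessel_succ a) I.absLam2_nonneg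
    refine (neg_le_neg h1).trans ?_
    rw [Finset.mul_sum, ← Finset.sum_neg_distrib]
    refine Finset.sum_le_sum fun i _ => ?_
    rw [← neg_mul]
    gcongr ?_ * _
    exact neg_le_of_abs_le (I.abs_lam_le_absLam2 (Fin.succ_ne_zero i))
  simp only [lam1, v1] at *
  linarith

lemma abs_f_le (a : E d) : |I.f a| ≤ I.lam1 * ‖a‖ ^ 2 := by
  have h1 := I.orthonormal.sum_inner_products_le a (s := Finset.univ)
  rw [f_eq_sum]
  refine (Finset.abs_sum_le_sum_abs _ _).trans ?_
  refine le_trans ?_ (mul_le_mul_of_nonneg_left h1 I.lam1_pos.le)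
  rw [Finset.mul_sum]
  refine Finset.sum_le_sum fun j _ => ?_
  rw [abs_mul, Real.norm_eq_abs, sq_abs, abs_of_nonneg (sq_nonneg ⟪I.v j, a⟫)]
  gcongr
  exact I.abs_lam_le j

lemma abs_f_le_lam1 {a : E d} (ha : ‖a‖ ≤ 1) : |I.f a| ≤ I.lam1 :=
  (I.abs_f_le a).trans (mul_le_of_le_one_right I.lam1_pos.le (pow_le_one₀ (norm_nonneg _) ha))

lemma fStar_eq : I.fStar = I.lam1 := by
  refine IsGreatest.csSup_eq ⟨⟨I.v1, by simp [I.norm_v1], ?_⟩, ?_⟩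
  · rw [f_eq_inner, inner_v1_op, real_inner_self_eq_norm_sq, I.norm_v1]; ring
  · rintro _ ⟨a, ha, rfl⟩
    exact (le_abs_self _).trans (I.abs_f_le_lam1 (by simpa using ha))

lemma regret_le_two {a : E d} (ha : ‖a‖ ≤ 1) : I.fStar - I.f a ≤ 2 * I.lam1 := by
  rw [fStar_eq]
  linarith [neg_le_of_abs_le (I.abs_f_le_lam1 ha)]

/-- The tangent of the angle between `a` and the line through `v₁` is at most `τ`. -/
def Aligned (τ : ℝ) (a : E d) : Prop :=
  ⟪I.v1, a⟫ ≠ 0 ∧ ‖I.perp a‖ ≤ τ * |⟪I.v1, a⟫|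

variable {I}

lemma Aligned.mono {τ τ' : ℝ} {a : E d} (h : I.Aligned τ a) (hτ : τ ≤ τ') : I.Aligned τ' a :=
  ⟨h.1, h.2.trans (by gcongr)⟩

lemma Aligned.smul {τ c : ℝ} {a : E d} (h : I.Aligned τ a) (hc : c ≠ 0) : I.Aligned τ (c • a) := by
  refine ⟨by rw [inner_smul_right]; exact mul_ne_zero hc h.1, ?_⟩
  rw [perp_smul, norm_smul, inner_smul_right, abs_mul, Real.norm_eq_abs, mul_left_comm]
  exact mul_le_mul_of_nonneg_left h.2 (abs_nonneg _)

lemma Aligned.ne_zero {τ : ℝ} {a : E d} (h : I.Aligned τ a) : a ≠ 0 := by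
  rintro rfl
  exact h.1 (inner_zero_right _)

/-- One step of the noisy power iteration. -/
lemma Aligned.step {τ ε R : ℝ} {a g : E d} (h : I.Aligned τ a) (ha : ‖a‖ = 1) (hε0 : 0 ≤ ε)
    (hε1 : ε ≤ 1) (hετ : ε ≤ τ) (hτR : τ ≤ R) (hR : 1 ≤ R) (hg : ‖g‖ ≤ I.gap * ε / 16)
    (hgv : |⟪I.v1, g⟫| ≤ I.gap / (32 * R)) :
    I.Aligned (max ε ((1 - 1 / (2 * I.kappa)) * τ)) (I.op a + g) := by
  obtain ⟨h0, h1⟩ := h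
  set p := |⟪I.v1, a⟫| with hp
  have hp0 : 0 < p := abs_pos.2 h0
  have hgap := I.gap_pos'
  have hl2 := I.absLam2_nonneg
  -- For a unit vector, `1 = p² + ‖perp a‖² ≤ p² (1 + τ²)`.
  have h1p : 1 ≤ p * (1 + τ) := by
    have hsq := I.norm_sq_eq a
    rw [ha, one_pow, ← sq_abs ⟪I.v1, a⟫, ← hp] at hsq
    by_contra! hlt
    nlinarith [norm_nonneg (I.perp a)]
  -- Since `p ≥ 1 / (2R)`, the absolute error along `v₁` becomes relative to `p`.
  have hgv' : |⟪I.v1, g⟫| ≤ I.gap * p / 16 := by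
    refine hgv.trans ?_
    rw [div_le_div_iff₀ (by positivity) (by norm_num)]
    have h2 : 1 ≤ p * (2 * R) := h1p.trans (by gcongr; linarith)
    nlinarith [mul_le_mul_of_nonneg_left h2 hgap.le]
  have hin : ⟪I.v1, I.op a + g⟫ = I.lam1 * ⟪I.v1, a⟫ + ⟪I.v1, g⟫ := by
    rw [inner_add_right, inner_v1_op]
  have hlow : p * (I.absLam2 + 15 / 16 * I.gap) ≤ |⟪I.v1, I.op a + g⟫| := by
    have h2 := abs_sub_abs_le_abs_sub (I.lam1 * ⟪I.v1, a⟫) (-⟪I.v1, g⟫)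
    rw [abs_neg, abs_mul, abs_of_pos I.lam1_pos, sub_neg_eq_add, ← hp] at h2
    rw [hin]
    have := I.lam1_eq
    rw [this] at h2 ⊢
    linarith
  have hup : ‖I.perp (I.op a + g)‖ ≤ p * τ * (I.absLam2 + I.gap / 8) := by
    rw [perp_add]
    refine (norm_add_le _ _).trans ?_
    have h2 := (I.norm_perp_op_le a).trans (mul_le_mul_of_nonneg_left h1 hl2)
    have h3 := (I.norm_perp_le g).trans hg
    have h4 : I.gap * ε / 16 ≤ I.gap * (p * (2 * τ)) / 16 := by
      gcongr I.gap * ?_ / 16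
      calc ε = ε * 1 := (mul_one _).symm
        _ ≤ ε * (p * (1 + τ)) := by gcongr
        _ = p * (ε + ε * τ) := by ring
        _ ≤ p * (2 * τ) := by
          gcongr
          nlinarith
    nlinarith
  have hpos : 0 < |⟪I.v1, I.op a + g⟫| := lt_of_lt_of_le (by positivity) hlow
  refine ⟨abs_pos.1 hpos, hup.trans ?_⟩
  have hτ0 : 0 ≤ τ := hε0.trans hετ
  -- Subtracting the `1 / (2κ)` share costs at most `Δ / 2`, and `15/16 - 1/2` still exceeds `1/8`.
  have hk : (I.absLam2 + I.gap / 8) ≤ (1 - 1 / (2 * I.kappa)) * (I.absLam2 + 15 / 16 * I.gap) := by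
    have h5 : 1 / (2 * I.kappa) = I.gap / (2 * I.lam1) := by
      rw [kappa]; field_simp
    have h6 : I.gap / (2 * I.lam1) * (I.absLam2 + 15 / 16 * I.gap) ≤ I.gap / 2 := by
      rw [div_mul_eq_mul_div, div_le_div_iff₀ (by linarith [I.lam1_pos]) two_pos]
      have := I.lam1_eq
      nlinarith
    rw [h5, sub_mul]
    linarith
  have hk0 : 0 ≤ 1 - 1 / (2 * I.kappa) := by
    have : 1 / (2 * I.kappa) ≤ 1 := by
      rw [div_le_one (by linarith [I.one_le_kappa])]; linarith [I.one_le_kappa]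
    linarith
  calc p * τ * (I.absLam2 + I.gap / 8)
      ≤ p * τ * ((1 - 1 / (2 * I.kappa)) * (I.absLam2 + 15 / 16 * I.gap)) := by gcongr
    _ = (1 - 1 / (2 * I.kappa)) * τ * (p * (I.absLam2 + 15 / 16 * I.gap)) := by ring
    _ ≤ (1 - 1 / (2 * I.kappa)) * τ * |⟪I.v1, I.op a + g⟫| := by gcongr
    -- The contraction holds without the maximum, which serves to preserve the hypothesis `ε ≤ τ`
    -- for the next step.
    _ ≤ _ := by gcongr; exact le_max_right _ _

/-- The deterministic noisy power iteration: normalized iterates `a l` with small errors converge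
geometrically until the accuracy `ε` is reached. -/
lemma aligned_iterate {ε R : ℝ} {a : ℕ → E d} {L : ℕ} (h0 : I.Aligned R (a 0)) (ha0 : ‖a 0‖ = 1)
    (hε0 : 0 ≤ ε) (hε1 : ε ≤ 1) (hR : 1 ≤ R)
    (hstep : ∀ l < L, ∃ (c : ℝ) (g : E d), 0 < c ∧ ‖g‖ ≤ I.gap * ε / 16 ∧
      |⟪I.v1, g⟫| ≤ I.gap / (32 * R) ∧
      a (l + 1) = ‖c • (I.op (a l) + g)‖⁻¹ • (c • (I.op (a l) + g))) :
    ‖a L‖ = 1 ∧ I.Aligned (max ε ((1 - 1 / (2 * I.kappa)) ^ L * R)) (a L) := by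
  have hk := I.one_le_kappa
  have hk0 : 0 ≤ 1 - 1 / (2 * I.kappa) := by
    have : 1 / (2 * I.kappa) ≤ 1 := by
      rw [div_le_one (by linarith)]; linarith
    linarith
  have hk1 : 1 - 1 / (2 * I.kappa) ≤ 1 := by
    have : 0 ≤ 1 / (2 * I.kappa) := by positivity
    linarith
  induction L with
  | zero => exact ⟨ha0, h0.mono (by simp)⟩
  | succ l ih =>
    obtain ⟨h1, h2⟩ := ih fun k hk => hstep k (hk.trans l.lt_succ_self)
    obtain ⟨c, g, hc, hg, hgv, heq⟩ := hstep l l.lt_succ_self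
    have h3 := h2.step h1 hε0 hε1 (le_max_left _ _)
      (max_le (hε1.trans hR) (mul_le_of_le_one_left (by linarith) (pow_le_one₀ hk0 hk1)))
      hR hg hgv
    have h4 : c • (I.op (a l) + g) ≠ 0 := smul_ne_zero hc.ne' h3.ne_zero
    rw [heq]
    refine ⟨norm_smul_inv_norm h4, ?_⟩
    -- Alignment is scale invariant, so neither `c` nor the normalization matters.
    refine ((h3.smul hc.ne').smul (inv_ne_zero (norm_ne_zero_iff.2 h4))).mono ?_
    refine max_le (le_max_left _ _) ?_
    rw [mul_max_of_nonneg _ _ hk0]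
    refine max_le ((mul_le_of_le_one_left hε0 hk1).trans (le_max_left _ _)) ?_
    rw [pow_succ']
    exact le_trans (le_of_eq (by ring)) (le_max_right _ _)

/-- A unit vector aligned with `v₁` up to `ε / 2` is an accurate output. -/
lemma Aligned.output {ε : ℝ} {a : E d} (h : I.Aligned (ε / 2) a) (ha : ‖a‖ = 1) (hε : 0 ≤ ε) :
    (∃ aStar : E d, (aStar = I.v1 ∨ aStar = -I.v1) ∧
      InnerProductGeometry.angle aStar a < Real.pi / 2 ∧
      Real.tan (InnerProductGeometry.angle aStar a) ≤ ε) ∧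
    I.fStar - I.f a ≤ I.fStar * ε ^ 2 := by
  obtain ⟨h0, h1⟩ := h
  have hsq := I.norm_sq_eq a
  rw [ha, one_pow] at hsq
  constructor
  · have key : ∀ w : E d, ‖w‖ = 1 → ⟪w, a⟫ = |⟪I.v1, a⟫| →
        InnerProductGeometry.angle w a < Real.pi / 2 ∧
          Real.tan (InnerProductGeometry.angle w a) ≤ ε := fun w hw hwa => by
      have hp : 0 < |⟪I.v1, a⟫| := abs_pos.2 h0
      refine ⟨?_, ?_⟩
      · rw [InnerProductGeometry.angle, Real.arccos_lt_pi_div_two, hwa, hw, ha]; simpa using hp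
      · rw [InnerProductGeometry.angle, Real.tan_arccos, hwa, hw, ha]
        simp only [mul_one, div_one, sq_abs]
        rw [show 1 - ⟪I.v1, a⟫ ^ 2 = ‖I.perp a‖ ^ 2 by linarith, Real.sqrt_sq (norm_nonneg _),
          div_le_iff₀ hp]
        nlinarith
    rcases le_total 0 ⟪I.v1, a⟫ with hs | hs
    · exact ⟨I.v1, Or.inl rfl, key _ I.norm_v1 (abs_of_nonneg hs).symm⟩
    · exact ⟨-I.v1, Or.inr rfl, key _ (by rw [norm_neg, I.norm_v1])
        (by rw [inner_neg_left, abs_of_nonpos hs])⟩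
  · have h2 := I.f_ge a
    rw [fStar_eq]
    have h3 : ‖I.perp a‖ ^ 2 ≤ (ε / 2) ^ 2 * ⟪I.v1, a⟫ ^ 2 := by
      rw [← sq_abs ⟪I.v1, a⟫, ← mul_pow]; gcongr
    have h4 : ⟪I.v1, a⟫ ^ 2 ≤ 1 := by nlinarith [sq_nonneg ‖I.perp a‖]
    -- The loss is at most `(λ₁ + |λ₂|) ‖perp a‖² ≤ 2 λ₁ ‖perp a‖²`; asking for the tangent `ε / 2`
    -- absorbs the factor two.
    have h5 : ‖I.perp a‖ ^ 2 ≤ ε ^ 2 / 4 := by nlinarith [sq_nonneg ε]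
    have h6 := I.lam1_eq
    have h7 := I.gap_pos'
    have h8 := I.lam1_pos
    nlinarith [mul_le_mul_of_nonneg_left h5 h8.le, sq_nonneg ‖I.perp a‖,
      mul_nonneg h8.le (sq_nonneg ε), mul_nonneg h7.le (sq_nonneg ‖I.perp a‖)]

end Problem

/-! ### Removing conditionally sub-Gaussian noise -/

/-- Disintegrating `P` along `m'` by the conditional kernel freezes `Ψ` and `W`. The bound on the
conditional moment generating function holds almost surely for all parameters at once, so the random
parameter `W ω` may be inserted. -/
lemma lintegral_mul_exp_le_of_condSubgaussian {Ω : Type*} {m' : MeasurableSpace Ω}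
    [mΩ : MeasurableSpace Ω] [StandardBorelSpace Ω] {P : Measure Ω} [IsProbabilityMeasure P]
    {hm : m' ≤ mΩ} {X W : Ω → ℝ} {Ψ : Ω → ℝ≥0∞} (h : HasCondSubgaussianMGF m' hm X 1 P)
    (hX : Measurable X) (hΨ : Measurable[m'] Ψ) (hW : Measurable[m'] W) :
    ∫⁻ ω, Ψ ω * ENNReal.ofReal (Real.exp (W ω * X ω - W ω ^ 2 / 2)) ∂P ≤ ∫⁻ ω, Ψ ω ∂P := by
  set Φ : Ω × Ω → ℝ≥0∞ :=
    fun p => Ψ p.1 * ENNReal.ofReal (Real.exp (W p.1 * X p.2 - W p.1 ^ 2 / 2)) with hΦ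
  have hΦm : Measurable[m'.prod mΩ] Φ := by
    have h1 : Measurable[m'.prod mΩ] fun p : Ω × Ω => Ψ p.1 := hΨ.comp measurable_fst
    have h2 : Measurable[m'.prod mΩ] fun p : Ω × Ω => W p.1 := hW.comp measurable_fst
    have h3 : Measurable[m'.prod mΩ] fun p : Ω × Ω => X p.2 := hX.comp measurable_snd
    exact h1.mul (ENNReal.measurable_ofReal.comp
      (Real.measurable_exp.comp ((h2.mul h3).sub ((h2.pow_const 2).div_const 2))))
  have hdiag : @Measurable Ω (Ω × Ω) mΩ (m'.prod mΩ) Function.diag :=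
    (measurable_id'' hm).prodMk measurable_id
  calc ∫⁻ ω, Ψ ω * ENNReal.ofReal (Real.exp (W ω * X ω - W ω ^ 2 / 2)) ∂P
      = ∫⁻ ω, Φ (Function.diag ω) ∂P := rfl
    _ = @lintegral _ (m'.prod mΩ) (@Measure.map Ω (Ω × Ω) mΩ (m'.prod mΩ) Function.diag P) Φ :=
        (@lintegral_map _ _ mΩ (m'.prod mΩ) _ _ _ hΦm hdiag).symm
    _ = @lintegral _ (m'.prod mΩ) ((P.trim hm) ⊗ₘ condExpKernel P m') Φ := by
        rw [compProd_trim_condExpKernel hm]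
    _ = ∫⁻ ω, ∫⁻ ω', Φ (ω, ω') ∂(condExpKernel P m' ω) ∂(P.trim hm) :=
        @Measure.lintegral_compProd _ _ m' mΩ _ _ _ _ _ hΦm
    _ ≤ ∫⁻ ω, Ψ ω ∂(P.trim hm) := by
        refine lintegral_mono_ae ?_
        filter_upwards [h.mgf_le, Kernel.HasSubgaussianMGF.ae_forall_integrable_exp_mul h]
          with ω h1 h2
        have h3 : ∫⁻ ω', ENNReal.ofReal (Real.exp (W ω * X ω' - W ω ^ 2 / 2))
            ∂(condExpKernel P m' ω) ≤ 1 := by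
          simp_rw [sub_eq_add_neg, Real.exp_add, ENNReal.ofReal_mul (Real.exp_pos _).le]
          rw [lintegral_mul_const _ (by fun_prop), ← ofReal_integral_eq_lintegral_ofReal (h2 _)
            (ae_of_all _ fun _ => (Real.exp_pos _).le), ← ENNReal.ofReal_mul
            (integral_nonneg fun _ => (Real.exp_pos _).le), ← ENNReal.ofReal_one]
          apply ENNReal.ofReal_le_ofReal
          have h4 := h1 (W ω)
          rw [mgf] at h4
          calc _ ≤ Real.exp ((1 : NNReal) * W ω ^ 2 / 2) * Real.exp (-(W ω ^ 2 / 2)) := by gcongr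
            _ = 1 := by rw [← Real.exp_add]; simp
        calc ∫⁻ ω', Φ (ω, ω') ∂(condExpKernel P m' ω)
            = Ψ ω * ∫⁻ ω', ENNReal.ofReal (Real.exp (W ω * X ω' - W ω ^ 2 / 2))
              ∂(condExpKernel P m' ω) := lintegral_const_mul (Ψ ω)
                (show Measurable fun ω' => ENNReal.ofReal (Real.exp (W ω * X ω' - W ω ^ 2 / 2)) by
                  fun_prop)
          _ ≤ Ψ ω := mul_le_of_le_one_right (zero_le) h3
    _ = ∫⁻ ω, Ψ ω ∂P := lintegral_trim hm hΨ

/-- The supermartingale argument: the last factor is removed conditionally on its past, with which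
all earlier factors and `Ψ` are measurable. -/
lemma lintegral_mul_prod_exp_le_of_condSubgaussian {Ω : Type*} [mΩ : MeasurableSpace Ω]
    [StandardBorelSpace Ω] {P : Measure Ω} [IsProbabilityMeasure P] {n : ℕ}
    {ℋ : ℕ → MeasurableSpace Ω} {X W : ℕ → Ω → ℝ} {Ψ : Ω → ℝ≥0∞}
    (h : ∀ i < n, ∃ hm : ℋ i ≤ mΩ, HasCondSubgaussianMGF (ℋ i) hm (X i) 1 P)
    (hX : ∀ i, Measurable (X i)) (hXi : ∀ i < n, ∀ j < i, Measurable[ℋ i] (X j))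
    (hW : ∀ i < n, ∀ j ≤ i, Measurable[ℋ i] (W j)) (hΨ : ∀ i < n, Measurable[ℋ i] Ψ) :
    ∫⁻ ω, Ψ ω * ∏ i ∈ Finset.range n,
      ENNReal.ofReal (Real.exp (W i ω * X i ω - W i ω ^ 2 / 2)) ∂P ≤ ∫⁻ ω, Ψ ω ∂P := by
  have key : ∀ k ≤ n, ∫⁻ ω, Ψ ω * ∏ i ∈ Finset.range k,
      ENNReal.ofReal (Real.exp (W i ω * X i ω - W i ω ^ 2 / 2)) ∂P ≤ ∫⁻ ω, Ψ ω ∂P := by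
    intro k
    induction k with
    | zero => simp
    | succ k ih =>
      intro hk
      obtain ⟨hm, hs⟩ := h k hk
      refine le_trans ?_ (ih (by omega))
      simp_rw [Finset.prod_range_succ, ← mul_assoc]
      refine lintegral_mul_exp_le_of_condSubgaussian hs (hX k) ?_ (hW k hk k le_rfl)
      refine (hΨ k hk).mul (Finset.measurable_fun_prod _ fun i hi => ?_)
      have hik := Finset.mem_range.1 hi
      have h1 := hXi k hk i hik
      have h2 := hW k hk i hik.le
      exact ENNReal.measurable_ofReal.comp
        (Real.measurable_exp.comp ((h2.mul h1).sub ((h2.pow_const 2).div_const 2)))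
  exact key n le_rfl

/-! ### Measurability of the iterates -/

/-- The σ-algebra is arbitrary, so that the lemma serves for the ambient one, for the past of a
batch and for `history`. -/
lemma measurable_npmIter {d : ℕ} {Ω : Type*} {m' : MeasurableSpace Ω} {f : E d → ℝ}
    (hf : Measurable f) (n : ℕ) (m : ℝ) {a₀ : Ω → E d} {z : ℕ → Ω → E d} {η : ℕ → Ω → ℝ} (l : ℕ)
    (ha : Measurable a₀) (hz : ∀ s < l * n, Measurable (z s)) (hη : ∀ s < l * n, Measurable (η s)) :
    Measurable fun ω => npmIter f n m (a₀ ω) (fun s => z s ω) (fun s => η s ω) l := by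
  induction l with
  | zero => exact ha
  | succ l ih =>
    have hle : l * n ≤ (l + 1) * n := Nat.mul_le_mul_right _ (Nat.le_succ l)
    have ha' := ih (fun s hs => hz s (hs.trans_le hle)) (fun s hs => hη s (hs.trans_le hle))
    have hsum : Measurable fun ω => ∑ i ∈ Finset.range n,
        (f ((1 / 2 : ℝ) • (npmIter f n m (a₀ ω) (fun s => z s ω) (fun s => η s ω) l +
          z (l * n + i) ω)) + η (l * n + i) ω) • z (l * n + i) ω := by
      refine Finset.measurable_fun_sum _ fun i hi => ?_
      have hi' : l * n + i < (l + 1) * n := by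
        rw [add_mul, one_mul]; exact Nat.add_lt_add_left (Finset.mem_range.1 hi) _
      have h1 := hz _ hi'
      have h2 : Measurable fun ω => (1 / 2 : ℝ) • (npmIter f n m (a₀ ω) (fun s => z s ω)
          (fun s => η s ω) l + z (l * n + i) ω) := (ha'.add h1).const_smul (1 / 2 : ℝ)
      exact ((hf.comp h2).add (hη _ hi')).smul h1
    have hy := hsum.const_smul (m / n : ℝ)
    exact hy.norm.inv.smul hy

/-- If `y = 0`, normalizing gives `0`, so the bound is an inequality; it suffices for feasibility of
the actions. -/
lemma norm_npmIter_le {d : ℕ} (f : E d → ℝ) (n : ℕ) (m : ℝ) {a₀ : E d} (z : ℕ → E d) (η : ℕ → ℝ)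
    (h : ‖a₀‖ ≤ 1) (l : ℕ) : ‖npmIter f n m a₀ z η l‖ ≤ 1 := by
  cases l with
  | zero => exact h
  | succ l =>
    simp only [npmIter]
    rw [norm_smul, norm_inv, norm_norm]
    exact inv_mul_le_one

/-! ### One direction of one batch -/

lemma lintegral_pi_prod {ι α : Type*} [Fintype ι] [MeasurableSpace α] (ν : Measure α)
    [IsProbabilityMeasure ν] {g : α → ℝ≥0∞} (hg : Measurable g) :
    ∫⁻ x : ι → α, ∏ i, g (x i) ∂(Measure.pi fun _ => ν) = (∫⁻ x, g x ∂ν) ^ Fintype.card ι := by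
  have hind : iIndepFun (fun (i : ι) (x : ι → α) => g (x i)) (Measure.pi fun _ : ι => ν) :=
    iIndepFun_pi (X := fun _ => g) fun _ => hg.aemeasurable
  rw [lintegral_prod_eq_prod_lintegral_of_indepFun Finset.univ _ hind
    fun i => hg.comp (measurable_pi_apply i)]
  simp_rw [fun i => (measurePreserving_eval (fun _ : ι => ν) i).lintegral_comp hg]
  simp

lemma measure_ge_le_exp_of_lintegral_exp_le {Ω : Type*} [MeasurableSpace Ω] {P : Measure Ω}
    {S : Ω → ℝ} (hS : Measurable S) {s t B : ℝ} (hs : 0 < s)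
    (h : ∫⁻ ω, ENNReal.ofReal (Real.exp (s * S ω)) ∂P ≤ ENNReal.ofReal (Real.exp B)) :
    P {ω | t ≤ S ω} ≤ ENNReal.ofReal (Real.exp (B - s * t)) := by
  have h1 : P {ω | t ≤ S ω} ≤
      P {ω | ENNReal.ofReal (Real.exp (s * t)) ≤ ENNReal.ofReal (Real.exp (s * S ω))} := by
    refine measure_mono fun ω hω => ?_
    exact ENNReal.ofReal_le_ofReal (Real.exp_le_exp.2 (mul_le_mul_of_nonneg_left hω hs.le))
  have h2 := meas_ge_le_lintegral_div (μ := P)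
    (f := fun ω => ENNReal.ofReal (Real.exp (s * S ω))) (by fun_prop)
    (ε := ENNReal.ofReal (Real.exp (s * t))) (by simp [Real.exp_pos]) ENNReal.ofReal_ne_top
  refine h1.trans (h2.trans ?_)
  rw [Real.exp_sub, ENNReal.ofReal_div_of_pos (Real.exp_pos _)]
  gcongr

section History

variable {d : ℕ} {Ω : Type*} {n : ℕ} {a₀ : Ω → E d} {z : ℕ → Ω → E d} {η : ℕ → Ω → ℝ} {t : ℕ}

lemma measurable_init_history : Measurable[history n a₀ z η t] a₀ :=
  measurable_fst.comp (comap_measurable (fun ω => (a₀ ω,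
    (fun s : Fin ((t / n + 1) * n) => z s ω), (fun s : Fin t => η s ω))))

lemma measurable_z_history {s : ℕ} (hs : s < (t / n + 1) * n) :
    Measurable[history n a₀ z η t] (z s) :=
  ((measurable_pi_apply (⟨s, hs⟩ : Fin ((t / n + 1) * n))).comp
    (measurable_fst.comp measurable_snd)).comp (comap_measurable (fun ω => (a₀ ω,
    (fun s : Fin ((t / n + 1) * n) => z s ω), (fun s : Fin t => η s ω))))

lemma measurable_noise_history {s : ℕ} (hs : s < t) : Measurable[history n a₀ z η t] (η s) :=
  ((measurable_pi_apply (⟨s, hs⟩ : Fin t)).comp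
    (measurable_snd.comp measurable_snd)).comp (comap_measurable (fun ω => (a₀ ω,
    (fun s : Fin ((t / n + 1) * n) => z s ω), (fun s : Fin t => η s ω))))

end History

/-- The exponential weight of one sample `x` in direction `u` at the iterate `a`, after the noise has
been integrated out. -/
def batchWeight {d : ℕ} (I : Problem d) (m c s : ℝ) (u a x : E d) : ℝ≥0∞ :=
  ENNReal.ofReal (Real.exp
    ((s * (I.f ((1 / 2 : ℝ) • (a + x)) * ⟪u, x⟫) + s ^ 2 * ⟪u, x⟫ ^ 2 / 2) -
      s * (c / m * ⟪(1 / 2 : ℝ) • I.op a, u⟫)))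

lemma measurable_batchWeight {d : ℕ} (I : Problem d) (m c s : ℝ) (u : E d) :
    Measurable fun p : E d × E d => batchWeight I m c s u p.1 p.2 := by
  have h1 : Measurable fun p : E d × E d => I.f ((1 / 2 : ℝ) • (p.1 + p.2)) :=
    I.continuous_f.measurable.comp (by fun_prop)
  have h2 : Measurable fun p : E d × E d => ⟪(1 / 2 : ℝ) • I.op p.1, u⟫ :=
    (show Continuous fun x : E d => ⟪(1 / 2 : ℝ) • I.op x, u⟫ by fun_prop).measurable.comp
      measurable_fst
  have h3 : Measurable fun p : E d × E d => ⟪u, p.2⟫ := by fun_prop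
  unfold batchWeight
  fun_prop

lemma measurable_prod_batchWeight {d : ℕ} (I : Problem d) (m c s : ℝ) (u : E d) (n : ℕ) :
    Measurable fun p : (Fin n → E d) × E d => ∏ i, batchWeight I m c s u p.2 (p.1 i) := by
  refine Finset.measurable_fun_prod _ fun i _ => ?_
  have h1 : Measurable fun p : (Fin n → E d) × E d => (p.2, p.1 i) :=
    measurable_snd.prodMk ((measurable_pi_apply i).comp measurable_fst)
  have h2 := (measurable_batchWeight I m c s u).comp h1
  exact h2

/-- The centring term in the weight cancels the mean, and only the quadratic exponent survives. -/
lemma lintegral_batchWeight_le {d : ℕ} {I : Problem d} {m : ℝ} (hm : 0 < m) (hdm : 2 * d ≤ m)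
    {c : ℝ} (hc : ∀ w u : E d, ∫ x, ⟪w, x⟫ * ⟪u, x⟫ ∂(truncGauss d m) = c / m * ⟪w, u⟫)
    {u : E d} (hu : ‖u‖ = 1) {s : ℝ} (hs : |s| ≤ √m / 8) {a : E d} (ha : ‖a‖ ≤ 1) :
    ∫⁻ x, batchWeight I m c s u a x ∂(truncGauss d m) ≤
      ENNReal.ofReal (Real.exp (1025 * s ^ 2 / m)) := by
  have hF1 : ∀ x : E d, ‖x‖ ≤ 1 → |I.f ((1 / 2 : ℝ) • (a + x))| ≤ 1 := fun x hx => by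
    refine (I.abs_f_le_lam1 ?_).trans I.lam1_le_one
    rw [norm_smul]
    have := norm_add_le a x
    norm_num
    linarith
  have h1 := lintegral_exp_truncGauss_le hm hdm hc
    (F := fun x => I.f ((1 / 2 : ℝ) • (a + x)))
    (h := fun x => 1 / 4 * I.f a + 1 / 4 * I.f x) (b := (1 / 2 : ℝ) • I.op a)
    (I.continuous_f.measurable.comp (by fun_prop)) hF1 (fun x => I.f_half_add a x)
    (fun x => by simp only [I.f_neg]) hu hs
  simp only [batchWeight]
  simp_rw [Real.exp_sub _ (s * (c / m * ⟪(1 / 2 : ℝ) • I.op a, u⟫)),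
    ENNReal.ofReal_div_of_pos (Real.exp_pos _), ENNReal.div_eq_inv_mul]
  rw [lintegral_const_mul' _ _ (by simp [Real.exp_pos])]
  rw [add_comm, Real.exp_add, ENNReal.ofReal_mul (Real.exp_pos _).le] at h1
  rw [← ENNReal.div_eq_inv_mul]
  exact ENNReal.div_le_of_le_mul h1

namespace IsRun

variable {d : ℕ} {I : Problem d} {Ω : Type*} [mΩ : MeasurableSpace Ω] [StandardBorelSpace Ω]
  {P : Measure Ω} [IsProbabilityMeasure P] {L n : ℕ} {m : ℝ}
  {a₀ : Ω → E d} {z : ℕ → Ω → E d} {η : ℕ → Ω → ℝ}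

lemma indepFun_iterate (h : IsRun P L n m a₀ z η) {l : ℕ} (hl : l < L) {f : E d → ℝ}
    (hf : Measurable f) :
    IndepFun (fun ω (i : Fin n) => z (l * n + i) ω)
      (fun ω => npmIter f n m (a₀ ω) (fun s => z s ω) (fun s => η s ω) l) P := by
  have h1 := h.indep_batch l hl
  rw [IndepFun_iff_Indep] at h1 ⊢
  refine indep_of_indep_of_le_right h1 ?_
  rw [← measurable_iff_comap_le]
  set past := fun ω => (a₀ ω, (fun s : Fin (l * n) => z s ω), (fun s : Fin (l * n) => η s ω))
    with hpast
  refine measurable_npmIter hf n m l ?_ (fun s hs => ?_) fun s hs => ?_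
  · exact measurable_fst.comp (comap_measurable past)
  · exact ((measurable_pi_apply (⟨s, hs⟩ : Fin (l * n))).comp
      (measurable_fst.comp measurable_snd)).comp (comap_measurable past)
  · exact ((measurable_pi_apply (⟨s, hs⟩ : Fin (l * n))).comp
      (measurable_snd.comp measurable_snd)).comp (comap_measurable past)

/-- By independence the joint law of batch and iterate is a product. For a fixed iterate the
integral over the batch is the `n`-th power of that of one sample. -/
lemma lintegral_prod_batchWeight_le (h : IsRun P L n m a₀ z η) (hm : 0 < m)
    (hdm : 2 * d ≤ m) {c : ℝ}
    (hc : ∀ w u : E d, ∫ x, ⟪w, x⟫ * ⟪u, x⟫ ∂(truncGauss d m) = c / m * ⟪w, u⟫)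
    {l : ℕ} (hl : l < L) {u : E d} (hu : ‖u‖ = 1) {s : ℝ} (hs : |s| ≤ √m / 8)
    {A : Ω → E d} (hA : Measurable A) (hA1 : ∀ᵐ ω ∂P, ‖A ω‖ ≤ 1)
    (hind : IndepFun (fun ω (i : Fin n) => z (l * n + i) ω) A P) :
    ∫⁻ ω, ∏ i ∈ Finset.range n, batchWeight I m c s u (A ω) (z (l * n + i) ω) ∂P ≤
      ENNReal.ofReal (Real.exp (n * (1025 * s ^ 2 / m))) := by
  have hprob := isProbabilityMeasure_truncGauss hm hdm
  have hGm := measurable_batchWeight I m c s u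
  have hbm : Measurable fun ω (i : Fin n) => z (l * n + i) ω :=
    measurable_pi_lambda _ fun i => h.measurable_z _
  have hmap := (indepFun_iff_map_prod_eq_prod_map_map hbm.aemeasurable hA.aemeasurable).1 hind
  rw [h.law_batch l hl, batchLaw_eq_pi d n m hm hdm] at hmap
  have hprodm := measurable_prod_batchWeight I m c s u n
  calc ∫⁻ ω, ∏ i ∈ Finset.range n, batchWeight I m c s u (A ω) (z (l * n + i) ω) ∂P
      = ∫⁻ ω, ∏ i : Fin n, batchWeight I m c s u (A ω) (z (l * n + i) ω) ∂P := by
        simp_rw [Finset.prod_range]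
    _ = ∫⁻ p, ∏ i, batchWeight I m c s u p.2 (p.1 i)
        ∂(P.map fun ω => ((fun i : Fin n => z (l * n + i) ω), A ω)) :=
        (lintegral_map hprodm (hbm.prodMk hA)).symm
    _ = ∫⁻ a, ∫⁻ x, ∏ i, batchWeight I m c s u a (x i)
        ∂(Measure.pi fun _ => truncGauss d m) ∂(P.map A) := by
        rw [hmap, lintegral_prod_symm _ hprodm.aemeasurable]
    _ ≤ ∫⁻ _, ENNReal.ofReal (Real.exp (n * (1025 * s ^ 2 / m))) ∂(P.map A) := by
        have hAle' : ∀ᵐ a ∂(P.map A), ‖a‖ ≤ 1 :=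
          (ae_map_iff hA.aemeasurable (measurableSet_le measurable_norm measurable_const)).2 hA1
        have hbd : ∀ᵐ a ∂(P.map A), ∫⁻ x, ∏ i, batchWeight I m c s u a (x i)
            ∂(Measure.pi fun _ : Fin n => truncGauss d m) ≤
              ENNReal.ofReal (Real.exp (n * (1025 * s ^ 2 / m))) := by
          filter_upwards [hAle'] with a ha
          have hga : Measurable fun x => batchWeight I m c s u a x := by
            have h1 := hGm.comp (measurable_prodMk_left (x := a))
            exact h1
          rw [lintegral_pi_prod _ hga, Fintype.card_fin, Real.exp_nat_mul,
            ENNReal.ofReal_pow (Real.exp_pos _).le]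
          exact pow_le_pow_left' (lintegral_batchWeight_le hm hdm hc hu hs ha) n
        exact lintegral_mono_ae hbd
    _ = _ := by
        rw [lintegral_const, Measure.map_apply hA MeasurableSet.univ, Set.preimage_univ,
          measure_univ, mul_one]

lemma lintegral_exp_batch_le (h : IsRun P L n m a₀ z η) (hn : 0 < n) (hm : 0 < m)
    (hdm : 2 * d ≤ m) (ha₀ : ∀ᵐ ω ∂P, ‖a₀ ω‖ ≤ 1) {c : ℝ}
    (hc : ∀ w u : E d, ∫ x, ⟪w, x⟫ * ⟪u, x⟫ ∂(truncGauss d m) = c / m * ⟪w, u⟫)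
    {l : ℕ} (hl : l < L) {u : E d} (hu : ‖u‖ = 1) {s : ℝ} (hs : |s| ≤ √m / 8) :
    ∫⁻ ω, ENNReal.ofReal (Real.exp (s * ∑ i ∈ Finset.range n,
      ((I.f ((1 / 2 : ℝ) • (npmIter I.f n m (a₀ ω) (fun s => z s ω) (fun s => η s ω) l +
        z (l * n + i) ω)) + η (l * n + i) ω) * ⟪u, z (l * n + i) ω⟫ -
        c / m * ⟪(1 / 2 : ℝ) • I.op (npmIter I.f n m (a₀ ω) (fun s => z s ω)
          (fun s => η s ω) l), u⟫))) ∂P ≤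
      ENNReal.ofReal (Real.exp (n * (1025 * s ^ 2 / m))) := by
  have hf : Measurable I.f := I.continuous_f.measurable
  set A := fun ω => npmIter I.f n m (a₀ ω) (fun s => z s ω) (fun s => η s ω) l with hA
  have hAm : ∀ m' : MeasurableSpace Ω, Measurable[m'] a₀ →
      (∀ s < l * n, Measurable[m'] (z s)) → (∀ s < l * n, Measurable[m'] (η s)) →
      Measurable[m'] A := fun m' => measurable_npmIter hf n m l
  have hA1 : ∀ᵐ ω ∂P, ‖A ω‖ ≤ 1 := by
    filter_upwards [ha₀] with ω hω using norm_npmIter_le _ _ _ _ _ hω l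
  have hAmeas : Measurable A := hAm mΩ h.measurable_init (fun s _ => h.measurable_z s)
    fun s _ => h.measurable_noise s
  have hmain := h.lintegral_prod_batchWeight_le (I := I) hm hdm hc hl hu hs hAmeas hA1
    (h.indepFun_iterate hl hf)
  -- The term `(s ⟪u, z⟫)² / 2` is added in the weight and subtracted in the noise factor, which
  -- makes the noise factors conditionally of mean at most one.
  have hpt (ω : Ω) : ENNReal.ofReal (Real.exp (s * ∑ i ∈ Finset.range n,
      ((I.f ((1 / 2 : ℝ) • (A ω + z (l * n + i) ω)) + η (l * n + i) ω) * ⟪u, z (l * n + i) ω⟫ -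
        c / m * ⟪(1 / 2 : ℝ) • I.op (A ω), u⟫))) =
      (∏ i ∈ Finset.range n, batchWeight I m c s u (A ω) (z (l * n + i) ω)) *
        ∏ i ∈ Finset.range n, ENNReal.ofReal (Real.exp ((s * ⟪u, z (l * n + i) ω⟫) *
          η (l * n + i) ω - (s * ⟪u, z (l * n + i) ω⟫) ^ 2 / 2)) := by
    rw [← Finset.prod_mul_distrib, Finset.mul_sum, Real.exp_sum,
      ENNReal.ofReal_prod_of_nonneg fun _ _ => (Real.exp_pos _).le]
    refine Finset.prod_congr rfl fun i _ => ?_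
    rw [batchWeight, ← ENNReal.ofReal_mul (Real.exp_pos _).le, ← Real.exp_add]
    congr 2
    ring
  rw [lintegral_congr hpt]
  obtain ⟨ℋ, hℋ⟩ : ∃ ℋ : ℕ → MeasurableSpace Ω, ∀ i, ℋ i = history n a₀ z η (l * n + i) :=
    ⟨_, fun _ => rfl⟩
  -- Hence the history of each round of batch `l` contains all samples of that batch, and the whole
  -- product of weights is measurable with respect to it.
  have hdiv (i : ℕ) (hi : i < n) : (l * n + i) / n = l := by
    rw [mul_comm, Nat.mul_add_div hn, Nat.div_eq_of_lt hi, add_zero]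
  have hlt (j : ℕ) (hj : j < n) : l * n + j < (l + 1) * n := by
    rw [add_mul, one_mul]; exact Nat.add_lt_add_left hj _
  have hzm (i : ℕ) (hi : i < n) (k : ℕ) (hk : k < (l + 1) * n) : Measurable[ℋ i] (z k) := by
    rw [hℋ]
    exact measurable_z_history (by rwa [hdiv i hi])
  have hηm (i : ℕ) (k : ℕ) (hk : k < l * n + i) : Measurable[ℋ i] (η k) := by
    rw [hℋ]
    exact measurable_noise_history hk
  have hAh (i : ℕ) (hi : i < n) : Measurable[ℋ i] A :=
    hAm _ (by rw [hℋ]; exact measurable_init_history)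
      (fun k hk => hzm i hi k (hk.trans_le (Nat.mul_le_mul_right _ (Nat.le_succ l))))
      fun k hk => hηm i k (by omega)
  have hη (i : ℕ) (hi : i < n) : ∃ hm : ℋ i ≤ mΩ,
      HasCondSubgaussianMGF (ℋ i) hm (η (l * n + i)) 1 P := by
    rw [hℋ]
    exact h.noise _ ((hlt i hi).trans_le (Nat.mul_le_mul_right _ hl))
  clear hℋ
  have hW (i : ℕ) (hi : i < n) (j : ℕ) (hj : j ≤ i) :
      Measurable[ℋ i] fun ω => s * ⟪u, z (l * n + j) ω⟫ := by
    have h1 : Measurable fun x : E d => s * ⟪u, x⟫ := by fun_prop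
    have h2 := h1.comp (hzm i hi _ (hlt j (hj.trans_lt hi)))
    exact h2
  have hΨ (i : ℕ) (hi : i < n) : Measurable[ℋ i] fun ω =>
      ∏ j ∈ Finset.range n, batchWeight I m c s u (A ω) (z (l * n + j) ω) := by
    refine Finset.measurable_fun_prod _ fun j hj => ?_
    have h1 := (hAh i hi).prodMk (hzm i hi _ (hlt j (Finset.mem_range.1 hj)))
    have h2 := (measurable_batchWeight I m c s u).comp h1
    exact h2
  exact (lintegral_mul_prod_exp_le_of_condSubgaussian hη (fun i => h.measurable_noise _)
    (fun i _ j hj => hηm i _ (by omega)) hW hΨ).trans hmain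

/-- In a fixed unit direction, the vector computed from a batch is close to a multiple of the image
of the current iterate. -/
lemma measure_batch_deviation_le (h : IsRun P L n m a₀ z η) (hn : 0 < n) (hm : 1 ≤ m)
    (hdm : 2 * d ≤ m) (ha₀ : ∀ᵐ ω ∂P, ‖a₀ ω‖ ≤ 1) {c : ℝ}
    (hc : ∀ w u : E d, ∫ x, ⟪w, x⟫ * ⟪u, x⟫ ∂(truncGauss d m) = c / m * ⟪w, u⟫)
    {l : ℕ} (hl : l < L) {u : E d} (hu : ‖u‖ = 1) {τ : ℝ} (hτ0 : 0 < τ) (hτ1 : τ ≤ 1) :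
    P {ω | τ ≤ |⟪u, (m / n) • ∑ i ∈ Finset.range n,
      (I.f ((1 / 2 : ℝ) • (npmIter I.f n m (a₀ ω) (fun s => z s ω) (fun s => η s ω) l +
        z (l * n + i) ω)) + η (l * n + i) ω) • z (l * n + i) ω⟫ -
        c / 2 * ⟪u, I.op (npmIter I.f n m (a₀ ω) (fun s => z s ω) (fun s => η s ω) l)⟫|} ≤
      ENNReal.ofReal (2 * Real.exp (-(n * τ ^ 2 / (4100 * m)))) := by
  have hm0 : 0 < m := by linarith
  have hn0 : (0 : ℝ) < n := by exact_mod_cast hn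
  set A := fun ω => npmIter I.f n m (a₀ ω) (fun s => z s ω) (fun s => η s ω) l with hA
  set S : Ω → ℝ := fun ω => ∑ i ∈ Finset.range n,
      ((I.f ((1 / 2 : ℝ) • (A ω + z (l * n + i) ω)) + η (l * n + i) ω) *
        ⟪u, z (l * n + i) ω⟫ - c / m * ⟪(1 / 2 : ℝ) • I.op (A ω), u⟫) with hS
  have hAm : Measurable A := measurable_npmIter I.continuous_f.measurable n m l h.measurable_init
    (fun s _ => h.measurable_z s) fun s _ => h.measurable_noise s
  have hSm : Measurable S := by
    refine Finset.measurable_fun_sum _ fun i _ => ?_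
    have h1 := h.measurable_z (l * n + i)
    have h2 : Measurable fun ω => I.f ((1 / 2 : ℝ) • (A ω + z (l * n + i) ω)) :=
      I.continuous_f.measurable.comp (by fun_prop)
    have h3 : Measurable fun ω => I.op (A ω) := I.continuous_op.measurable.comp hAm
    have h4 := h.measurable_noise (l * n + i)
    fun_prop
  have hSeq (ω : Ω) : ⟪u, (m / n) • ∑ i ∈ Finset.range n,
      (I.f ((1 / 2 : ℝ) • (A ω + z (l * n + i) ω)) + η (l * n + i) ω) • z (l * n + i) ω⟫ -
        c / 2 * ⟪u, I.op (A ω)⟫ = m / n * S ω := by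
    simp only [hS, Finset.sum_sub_distrib, inner_smul_right, inner_sum, Finset.sum_const,
      Finset.card_range, nsmul_eq_mul, real_inner_smul_left]
    rw [real_inner_comm u]
    field_simp
  -- `s = τ / 2050` minimizes the Chernoff exponent `n (1025 s² - s τ) / m`, with value `-n τ² /
  -- (4100 m)`; it is admissible since `τ ≤ 1 ≤ √m`.
  have hsm : τ / 2050 ≤ √m / 8 := by
    have : 1 ≤ √m := Real.one_le_sqrt.2 hm
    linarith
  have hexp (s : ℝ) := h.lintegral_exp_batch_le (I := I) hn hm0 hdm ha₀ hc hl hu (s := s)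
  have hpos : P {ω | n * τ / m ≤ S ω} ≤
      ENNReal.ofReal (Real.exp (-(n * τ ^ 2 / (4100 * m)))) := by
    refine (measure_ge_le_exp_of_lintegral_exp_le hSm (s := τ / 2050) (by positivity)
      (hexp (τ / 2050) (by rwa [abs_of_pos (by positivity)]))).trans_eq ?_
    congr 2
    field_simp
    ring
  have hneg : P {ω | n * τ / m ≤ -S ω} ≤
      ENNReal.ofReal (Real.exp (-(n * τ ^ 2 / (4100 * m)))) := by
    have h1 := hexp (-(τ / 2050)) (by rwa [abs_neg, abs_of_pos (by positivity)])
    simp_rw [neg_mul (τ / 2050), ← mul_neg (τ / 2050)] at h1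
    refine (measure_ge_le_exp_of_lintegral_exp_le hSm.neg (s := τ / 2050) (by positivity)
      h1).trans_eq ?_
    congr 2
    field_simp
    ring
  have hsub : {ω | τ ≤ |m / n * S ω|} ⊆ {ω | n * τ / m ≤ S ω} ∪ {ω | n * τ / m ≤ -S ω} := by
    intro ω hω
    change τ ≤ |m / n * S ω| at hω
    rw [abs_mul, abs_of_pos (div_pos hm0 hn0), div_mul_eq_mul_div, le_div_iff₀ hn0] at hω
    have : n * τ / m ≤ |S ω| := by rw [div_le_iff₀ hm0]; linarith
    exact le_abs.1 this
  change P {ω | τ ≤ |⟪u, (m / n) • ∑ i ∈ Finset.range n,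
      (I.f ((1 / 2 : ℝ) • (A ω + z (l * n + i) ω)) + η (l * n + i) ω) • z (l * n + i) ω⟫ -
        c / 2 * ⟪u, I.op (A ω)⟫|} ≤ _
  simp_rw [hSeq]
  refine (measure_mono hsub).trans ((measure_union_le _ _).trans ((add_le_add hpos hneg).trans ?_))
  rw [← ENNReal.ofReal_add (Real.exp_pos _).le (Real.exp_pos _).le, two_mul]

end IsRun

/-! ### Anticoncentration of the uniform law on the sphere -/

/-- A slab of half-width `1 / (200 √d)` through the centre takes up at most a twentieth of the unit
ball: a hundred disjoint translates of it fit into a slightly larger ball. -/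
lemma volume_slab_le {d : ℕ} (hd : 0 < d) {v : E d} (hv : ‖v‖ = 1) :
    (volume : Measure (E d)).real {x | ‖x‖ < 1 ∧ |⟪v, x⟫| < 1 / (200 * √d)} ≤
      0.05 * (volume : Measure (E d)).real (Metric.ball 0 1) := by
  set S : Set (E d) := {x | ‖x‖ < 1 ∧ |⟪v, x⟫| < 1 / (200 * √d)} with hS
  have hd0 : (0 : ℝ) < d := by exact_mod_cast hd
  have hsd : 0 < √(d : ℝ) := Real.sqrt_pos.2 hd0
  set h : ℝ := 1 / (200 * √d) with hh
  have hh0 : 0 < h := by positivity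
  have hhd : h ^ 2 * 40000 = 1 / d := by
    rw [hh, div_pow, mul_pow, Real.sq_sqrt hd0.le]; field_simp; norm_num
  have hSm : MeasurableSet S :=
    (measurableSet_lt measurable_norm measurable_const).inter
      (measurableSet_lt (show Measurable fun x : E d => |⟪v, x⟫| by fun_prop) measurable_const)
  -- Translates of the slab by multiples of its own width, hence disjoint.
  set T : ℕ → Set (E d) := fun k => (fun x => x + (-(2 * h * k)) • v) ⁻¹' S with hT
  have hTv (k : ℕ) : (volume : Measure (E d)) (T k) = volume S :=
    measure_preimage_add_right _ _ _
  have hTm (k : ℕ) : MeasurableSet (T k) := hSm.preimage (by fun_prop)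
  have hvv : ⟪v, v⟫ = 1 := by rw [real_inner_self_eq_norm_sq, hv, one_pow]
  have hTmem {k : ℕ} {x : E d} (hx : x ∈ T k) :
      ‖x + (-(2 * h * k)) • v‖ < 1 ∧ |⟪v, x⟫ - 2 * h * k| < h := by
    obtain ⟨h1, h2⟩ := hx
    rw [inner_add_right, inner_smul_right, hvv] at h2
    exact ⟨h1, by rwa [mul_one, ← sub_eq_add_neg] at h2⟩
  have hdisj : Set.PairwiseDisjoint (Finset.range 100 : Set ℕ) T := by
    intro i _ j _ hij
    rw [Function.onFun, Set.disjoint_left]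
    intro x hxi hxj
    have h1 := abs_lt.1 (hTmem hxi).2
    have h2 := abs_lt.1 (hTmem hxj).2
    have key : ∀ p q : ℕ, p < q → ⟪v, x⟫ - 2 * h * p < h → -h < ⟪v, x⟫ - 2 * h * q → False := by
      intro p q hpq h3 h4
      have : (p : ℝ) + 1 ≤ q := by exact_mod_cast hpq
      nlinarith
    rcases lt_or_gt_of_ne hij with hlt | hlt
    · exact key i j hlt h1.2 h2.1
    · exact key j i hlt h2.2 h1.1
  -- A point of the translate by `w = 2hk ≤ 200h` has `‖x‖² < 1 + w² + 2wh ≤ 1 + 80000 h² = 1 +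
  -- 2/d`. So the volume grows by `ρ ^ d ≤ e < 5` only, and `5 / 100` is the claimed share.
  set ρ : ℝ := √(1 + 2 / d) with hρ
  have hsub : (⋃ k ∈ Finset.range 100, T k) ⊆ Metric.ball 0 ρ := by
    intro x hx
    obtain ⟨k, hk, hxk⟩ := Set.mem_iUnion₂.1 hx
    have hk' : (k : ℝ) ≤ 100 := by exact_mod_cast (Finset.mem_range.1 hk).le
    obtain ⟨h1, h2⟩ := hTmem hxk
    rw [mem_ball_zero_iff, hρ]
    refine Real.lt_sqrt_of_sq_lt ?_
    have h3 : ‖x + (-(2 * h * k)) • v‖ ^ 2 < 1 := by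
      rw [sq_lt_one_iff₀ (norm_nonneg _)]; exact h1
    rw [@norm_add_sq_real, norm_smul, hv, inner_smul_right, real_inner_comm, mul_one,
      Real.norm_eq_abs, sq_abs] at h3
    have h4 := (abs_lt.1 h2).2
    have h5 : 0 ≤ 2 * h * k := by positivity
    have h6 : 2 * h * k ≤ 200 * h := by nlinarith
    have h7 : 2 / (d : ℝ) = 80000 * h ^ 2 := by rw [div_eq_mul_one_div, ← hhd]; ring
    rw [h7]
    nlinarith
  have hρd : ρ ^ d ≤ 5 := by
    have h1 : (ρ ^ d) ^ 2 ≤ 25 := by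
      rw [← pow_mul, mul_comm, pow_mul, hρ, Real.sq_sqrt (by positivity)]
      calc (1 + 2 / (d : ℝ)) ^ d ≤ Real.exp (2 / d) ^ d := by
            gcongr; linarith [Real.add_one_le_exp (2 / (d : ℝ))]
        _ = Real.exp 1 ^ 2 := by
            rw [← Real.exp_nat_mul, ← Real.exp_nat_mul]; congr 1; field_simp; norm_num
        _ ≤ 5 ^ 2 := by gcongr; linarith [Real.exp_one_lt_d9]
        _ = 25 := by norm_num
    nlinarith [pow_nonneg (Real.sqrt_nonneg (1 + 2 / (d : ℝ))) d]
  have hvol : 100 * (volume : Measure (E d)) S ≤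
      ENNReal.ofReal (ρ ^ d) * volume (Metric.ball (0 : E d) 1) := by
    have h1 := measure_mono (μ := (volume : Measure (E d))) hsub
    rw [measure_biUnion_finset hdisj fun k _ => hTm k,
      Measure.addHaar_ball_of_pos _ _ (Real.sqrt_pos.2 (by positivity)),
      finrank_euclideanSpace_fin] at h1
    simp only [hTv, Finset.sum_const, Finset.card_range, nsmul_eq_mul, Nat.cast_ofNat] at h1
    exact h1
  have hreal := ENNReal.toReal_mono
    (ENNReal.mul_ne_top ENNReal.ofReal_ne_top measure_ball_lt_top.ne) hvol
  rw [ENNReal.toReal_mul, ENNReal.toReal_mul, ENNReal.toReal_ofReal (by positivity)] at hreal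
  simp only [ENNReal.toReal_ofNat] at hreal
  have hb : 0 ≤ (volume (Metric.ball (0 : E d) 1)).toReal := ENNReal.toReal_nonneg
  rw [measureReal_def, measureReal_def]
  nlinarith

lemma ae_norm_sphereUniform (d : ℕ) : ∀ᵐ x ∂(sphereUniform d), ‖x‖ = 1 := by
  rw [sphereUniform, ae_map_iff measurable_subtype_coe.aemeasurable
    (measurableSet_eq_fun measurable_norm measurable_const)]
  exact ae_of_all _ fun x => by simp

open scoped Pointwise in
-- The measure of a spherical set is proportional to the volume of the cone over it, and the cone
-- over the spherical slab lies in the solid slab.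
lemma sphereUniform_slab_le {d : ℕ} (hd : 0 < d) {v : E d} (hv : ‖v‖ = 1) :
    (sphereUniform d).real {x | |⟪v, x⟫| < 1 / (200 * √d)} ≤ 0.05 := by
  have hm : MeasurableSet {x : E d | |⟪v, x⟫| < 1 / (200 * √d)} :=
    measurableSet_lt (by fun_prop) measurable_const
  have hball : 0 < (volume : Measure (E d)).real (Metric.ball 0 1) :=
    ENNReal.toReal_pos (Metric.measure_ball_pos _ _ one_pos).ne' measure_ball_lt_top.ne
  have hsub : Set.Ioo (0 : ℝ) 1 • ((↑) '' (Subtype.val ⁻¹' {x : E d | |⟪v, x⟫| < 1 / (200 * √d)} :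
      Set (Metric.sphere (0 : E d) 1)) : Set (E d)) ⊆
      {x | ‖x‖ < 1 ∧ |⟪v, x⟫| < 1 / (200 * √d)} := by
    rintro _ ⟨r, hr, _, ⟨x, hx, rfl⟩, rfl⟩
    have hx' : |⟪v, x⟫| < 1 / (200 * √d) := hx
    refine ⟨?_, ?_⟩
    · simp only [norm_smul, norm_eq_of_mem_sphere, mul_one, Real.norm_eq_abs, abs_of_pos hr.1, hr.2]
    · simp only [inner_smul_right]
      rw [abs_mul, abs_of_pos hr.1]
      exact (mul_le_of_le_one_left (abs_nonneg _) hr.2.le).trans_lt hx'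
  have hfin : (volume : Measure (E d)) {x | ‖x‖ < 1 ∧ |⟪v, x⟫| < 1 / (200 * √d)} ≠ ∞ :=
    ((measure_mono fun x hx => mem_ball_zero_iff.2 hx.1).trans_lt
      (measure_ball_lt_top (x := (0 : E d)) (r := 1))).ne
  have h1 := (ENNReal.toReal_mono hfin (measure_mono hsub)).trans (volume_slab_le hd hv)
  rw [measureReal_def, sphereUniform, Measure.map_apply measurable_subtype_coe hm,
    cond_apply MeasurableSet.univ, Set.univ_inter, Measure.toSphere_apply_univ,
    Measure.toSphere_apply' _ (hm.preimage measurable_subtype_coe), ENNReal.toReal_mul,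
    ENNReal.toReal_inv, ENNReal.toReal_mul, ENNReal.toReal_mul, finrank_euclideanSpace_fin]
  rw [ENNReal.toReal_natCast, ← div_eq_inv_mul, mul_div_mul_left _ _ (by positivity),
    ← measureReal_def (volume : Measure (E d)) (Metric.ball 0 1), div_le_iff₀ hball]
  exact h1

/-! ### Parameter estimates -/

namespace Problem

variable {d : ℕ} (I : Problem d) {CL Cm Cn ε : ℝ}

lemma one_le_dim (I : Problem d) : (1 : ℝ) ≤ d := by exact_mod_cast I.dim_pos

lemma one_le_numIter : (1 : ℝ) ≤ I.numIter CL ε := by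
  rw [numIter]; push_cast; linarith [Nat.cast_nonneg (α := ℝ) ⌊CL * I.kappa * Real.log (d / ε)⌋₊]

lemma delta_pos : 0 < I.delta CL ε := by
  have := I.one_le_numIter (CL := CL) (ε := ε)
  rw [delta]; positivity

lemma delta_le : I.delta CL ε ≤ 0.1 := by
  have := I.one_le_numIter (CL := CL) (ε := ε)
  rw [delta, div_le_iff₀ (by linarith)]; linarith

lemma two_le_dim_div_gap_mul (hε0 : 0 < ε) (hε : ε < 1 / 2) : 2 ≤ d / (I.gap * ε) := by
  have h1 := I.gap_pos'
  have h2 := I.gap_le_one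
  have h3 := I.one_le_dim
  rw [le_div_iff₀ (by positivity)]
  nlinarith

lemma dim_div_eq (hε0 : 0 < ε) :
    d / (I.delta CL ε * I.gap * ε) = 10 * I.numIter CL ε * (d / (I.gap * ε)) := by
  have h1 := I.gap_pos'
  have h2 := I.one_le_numIter (CL := CL) (ε := ε)
  rw [delta, show (0.1 : ℝ) = 1 / 10 by norm_num]
  field_simp

lemma twenty_le_dim_div (hε0 : 0 < ε) (hε : ε < 1 / 2) :
    20 ≤ d / (I.delta CL ε * I.gap * ε) := by
  have h1 := I.two_le_dim_div_gap_mul hε0 hε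
  have h2 := I.one_le_numIter (CL := CL) (ε := ε)
  rw [I.dim_div_eq hε0]
  nlinarith

lemma two_le_log_of_ten_le {x : ℝ} (hx : 10 ≤ x) : 2 ≤ Real.log x := by
  rw [Real.le_log_iff_exp_le (by linarith)]
  have h : Real.exp 2 = Real.exp 1 ^ 2 := by rw [← Real.exp_nat_mul]; norm_num
  rw [h]
  have := Real.exp_one_lt_d9
  nlinarith [Real.exp_pos 1]

lemma batchSize_ge : Cn * (d : ℝ) ^ 2 * Real.log (d / (I.delta CL ε * I.gap * ε)) ^ 4 /
    (I.gap ^ 2 * ε ^ 2) ≤ I.batchSize CL Cn ε := Nat.le_ceil _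

lemma one_le_batchSize_arg (hCn : 1 ≤ Cn) (hε0 : 0 < ε) (hε : ε < 1 / 2) :
    1 ≤ Cn * (d : ℝ) ^ 2 * Real.log (d / (I.delta CL ε * I.gap * ε)) ^ 4 /
      (I.gap ^ 2 * ε ^ 2) := by
  have h1 := I.gap_pos'
  have h2 := I.gap_le_one
  have h3 := I.one_le_dim
  have h4 := two_le_log_of_ten_le (x := d / (I.delta CL ε * I.gap * ε))
    (by linarith [I.twenty_le_dim_div (CL := CL) hε0 hε])
  rw [le_div_iff₀ (by positivity), one_mul]
  calc I.gap ^ 2 * ε ^ 2 ≤ 1 * 1 := by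
        gcongr
        · exact pow_le_one₀ h1.le h2
        · exact pow_le_one₀ hε0.le (by linarith)
    _ = 1 * 1 ^ 2 * 1 ^ 4 := by norm_num
    _ ≤ _ := by gcongr; linarith

lemma batchSize_le (hCn : 1 ≤ Cn) (hε0 : 0 < ε) (hε : ε < 1 / 2) :
    (I.batchSize CL Cn ε : ℝ) ≤ 2 * (Cn * (d : ℝ) ^ 2 *
      Real.log (d / (I.delta CL ε * I.gap * ε)) ^ 4 / (I.gap ^ 2 * ε ^ 2)) := by
  have h1 := I.one_le_batchSize_arg (CL := CL) hCn hε0 hε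
  have h2 := Nat.ceil_lt_add_one (zero_le_one.trans h1)
  rw [batchSize]
  linarith

lemma batchSize_pos (hCn : 1 ≤ Cn) (hε0 : 0 < ε) (hε : ε < 1 / 2) :
    0 < I.batchSize CL Cn ε :=
  Nat.ceil_pos.2 (zero_lt_one.trans_le (I.one_le_batchSize_arg hCn hε0 hε))

lemma two_le_log_batchSize_div (hCn : 1 ≤ Cn) (hε0 : 0 < ε) (hε : ε < 1 / 2) :
    2 ≤ Real.log (I.batchSize CL Cn ε / I.delta CL ε) := by
  refine two_le_log_of_ten_le ?_
  have h1 : (1 : ℝ) ≤ I.batchSize CL Cn ε := by exact_mod_cast I.batchSize_pos hCn hε0 hε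
  rw [le_div_iff₀ I.delta_pos]
  linarith [I.delta_le (CL := CL) (ε := ε)]

lemma precision_ge (hCm : 256 ≤ Cm) (hCn : 1 ≤ Cn) (hε0 : 0 < ε) (hε : ε < 1 / 2) :
    512 * d ≤ I.precision CL Cm Cn ε := by
  have h1 := I.two_le_log_batchSize_div (CL := CL) hCn hε0 hε
  have h3 := I.one_le_dim
  rw [precision]
  calc 512 * (d : ℝ) = 256 * d * 2 := by ring
    _ ≤ _ := by gcongr

/-- `n / δ` is at most `2 C_n X⁶` with `X = d / (δΔε)`. The dependence on `C_n` is bounded by a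
square root so that the factor `C_n` in `n` can beat it. -/
lemma log_batchSize_div_le (hCn : 1 ≤ Cn) (hε0 : 0 < ε) (hε : ε < 1 / 2) :
    Real.log (I.batchSize CL Cn ε / I.delta CL ε) ≤
      9 * √Cn * Real.log (d / (I.delta CL ε * I.gap * ε)) := by
  have hX := I.twenty_le_dim_div (CL := CL) hε0 hε
  have hδ := I.delta_pos (CL := CL) (ε := ε)
  have hδ1 := I.delta_le (CL := CL) (ε := ε)
  have hn := I.batchSize_le (CL := CL) hCn hε0 hε
  have hn1 : (0 : ℝ) < I.batchSize CL Cn ε := by exact_mod_cast I.batchSize_pos hCn hε0 hε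
  have hg := I.gap_pos'
  set X := d / (I.delta CL ε * I.gap * ε) with hXdef
  have hℓ2 := two_le_log_of_ten_le (x := X) (by linarith)
  have hℓX : Real.log X ≤ X := (Real.log_le_sub_one_of_pos (by linarith)).trans (by linarith)
  have h1 : I.batchSize CL Cn ε / I.delta CL ε ≤ 2 * Cn * X ^ 6 := by
    rw [div_le_iff₀ hδ]
    refine hn.trans ?_
    have h2 : (d : ℝ) ^ 2 / (I.gap ^ 2 * ε ^ 2) = X ^ 2 * I.delta CL ε ^ 2 := by
      rw [hXdef]; field_simp
    calc 2 * (Cn * (d : ℝ) ^ 2 * Real.log X ^ 4 / (I.gap ^ 2 * ε ^ 2))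
        = 2 * Cn * Real.log X ^ 4 * ((d : ℝ) ^ 2 / (I.gap ^ 2 * ε ^ 2)) := by ring
      _ = 2 * Cn * Real.log X ^ 4 * X ^ 2 * I.delta CL ε * I.delta CL ε := by rw [h2]; ring
      _ ≤ 2 * Cn * X ^ 4 * X ^ 2 * I.delta CL ε * 1 := by gcongr; linarith
      _ = _ := by ring
  have h2 := Real.log_le_log (by positivity) h1
  rw [Real.log_mul (by positivity) (by positivity), Real.log_pow] at h2
  have hs1 : 1 ≤ √Cn := Real.one_le_sqrt.2 hCn
  have h3 : Real.log (2 * Cn) ≤ 3 * √Cn := by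
    have h4 : Real.log (√(2 * Cn)) ≤ √(2 * Cn) :=
      (Real.log_le_sub_one_of_pos (by positivity)).trans (by linarith)
    rw [Real.log_sqrt (by positivity), Real.sqrt_mul two_pos.le] at h4
    have h5 : √2 ≤ 3 / 2 := by rw [Real.sqrt_le_iff]; norm_num
    nlinarith
  push_cast at h2
  nlinarith

/-- With `ℓ` the logarithm, `n τ²` is of order `C_n d ℓ⁴` and `m` of order `C_m √C_n d ℓ`; the
hypothesis on `C_n` says that the remaining `√C_n` dominates all constants. The factor two yields a
failure probability of order `X⁻²` per event. -/
lemma exponent_ge (hCm : 256 ≤ Cm) (hCn : (18 * (25600 ^ 2 * 4100) * Cm) ^ 2 ≤ Cn)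
    (hε0 : 0 < ε) (hε : ε < 1 / 2) :
    2 * Real.log (d / (I.delta CL ε * I.gap * ε)) ≤
      I.batchSize CL Cn ε * (I.gap * ε / (25600 * √d)) ^ 2 /
        (4100 * I.precision CL Cm Cn ε) := by
  have hCn1 : 1 ≤ Cn := by nlinarith
  have hsq : 18 * (25600 ^ 2 * 4100) * Cm ≤ √Cn := Real.le_sqrt_of_sq_le hCn
  have hs0 : 0 < √Cn := by positivity
  have hCnsq : √Cn ^ 2 = Cn := Real.sq_sqrt (by linarith)
  have hX := I.twenty_le_dim_div (CL := CL) hε0 hε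
  have hn := I.batchSize_ge (CL := CL) (Cn := Cn) (ε := ε)
  have hlog := I.log_batchSize_div_le (CL := CL) hCn1 hε0 hε
  have hlog2 := I.two_le_log_batchSize_div (CL := CL) hCn1 hε0 hε
  have hg := I.gap_pos'
  have hd := I.one_le_dim
  rw [precision]
  set lg := Real.log (I.batchSize CL Cn ε / I.delta CL ε)
  set ℓ := Real.log (d / (I.delta CL ε * I.gap * ε))
  have hℓ2 : 2 ≤ ℓ := two_le_log_of_ten_le (by linarith)
  rw [le_div_iff₀ (by positivity), div_pow, mul_pow (25600 : ℝ), Real.sq_sqrt (by linarith)]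
  calc 2 * ℓ * (4100 * (Cm * d * lg)) ≤ 2 * ℓ * (4100 * (Cm * d * (9 * √Cn * ℓ))) := by gcongr
    _ = (18 * (25600 ^ 2 * 4100) * Cm) * √Cn * ℓ ^ 2 * (d / 25600 ^ 2) := by ring
    _ ≤ √Cn * √Cn * ℓ ^ 4 * (d / 25600 ^ 2) := by
        gcongr
        · linarith
        · norm_num
    _ = Cn * (d : ℝ) ^ 2 * ℓ ^ 4 / (I.gap ^ 2 * ε ^ 2) * ((I.gap * ε) ^ 2 / (25600 ^ 2 * d)) := by
        rw [← pow_two, hCnsq]; field_simp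
    _ ≤ _ := by gcongr

/-- The union bound over all iterations and directions costs at most a twentieth. -/
lemma union_bound (hCm : 256 ≤ Cm) (hCn : (18 * (25600 ^ 2 * 4100) * Cm) ^ 2 ≤ Cn)
    (hε0 : 0 < ε) (hε : ε < 1 / 2) :
    I.numIter CL ε * ((d + 1 : ℝ) * (2 * Real.exp (-(I.batchSize CL Cn ε *
      (I.gap * ε / (25600 * √d)) ^ 2 / (4100 * I.precision CL Cm Cn ε))))) ≤ 0.05 := by
  have h1 := I.exponent_ge (CL := CL) hCm hCn hε0 hε
  have hX := I.twenty_le_dim_div (CL := CL) hε0 hε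
  have heq := I.dim_div_eq (CL := CL) hε0
  have hd := I.one_le_dim
  have hg := I.gap_pos'
  have hL := I.one_le_numIter (CL := CL) (ε := ε)
  set X := d / (I.delta CL ε * I.gap * ε) with hXdef
  have hX0 : 0 < X := by linarith
  have h2 : Real.exp (-(I.batchSize CL Cn ε * (I.gap * ε / (25600 * √d)) ^ 2 /
      (4100 * I.precision CL Cm Cn ε))) ≤ 1 / X ^ 2 := by
    refine (Real.exp_le_exp.2 (neg_le_neg h1)).trans_eq ?_
    rw [Real.exp_neg, two_mul, Real.exp_add, Real.exp_log hX0, one_div, pow_two]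
  -- `X = 10 L d / (Δε)` counts the iterations as well, so one factor `X⁻¹` pays for all `L (d + 1)`
  -- events.
  have h3 : I.numIter CL ε * (d : ℝ) ≤ X / 20 := by
    have h4 : (2 : ℝ) * d ≤ d / (I.gap * ε) := by
      rw [le_div_iff₀ (by positivity)]
      have h5 : I.gap * ε ≤ 1 * (1 / 2) := by gcongr; exact I.gap_le_one
      nlinarith
    rw [heq]
    nlinarith
  calc _ ≤ I.numIter CL ε * ((d + d : ℝ) * (2 * (1 / X ^ 2))) := by gcongr
    _ = 4 * (I.numIter CL ε * d) * (1 / X ^ 2) := by ring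
    _ ≤ 4 * (X / 20) * (1 / X ^ 2) := by gcongr
    _ = 1 / (5 * X) := by field_simp; norm_num
    _ ≤ 0.05 := by
        rw [div_le_iff₀ (by positivity)]; linarith

/-- After `numIter` contractions the initial tangent is below the accuracy. -/
lemma contraction_le (hCL : 20 ≤ CL) (hε0 : 0 < ε) (hε : ε < 1 / 2) :
    (1 - 1 / (2 * I.kappa)) ^ I.numIter CL ε * (200 * √d) ≤ ε / 2 := by
  have hk := I.one_le_kappa
  have hd := I.one_le_dim
  have hlog : 0 ≤ Real.log (d / ε) := Real.log_nonneg (by rw [le_div_iff₀ hε0]; linarith)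
  have hL : 20 * I.kappa * Real.log (d / ε) ≤ I.numIter CL ε := by
    have h1 := (Nat.lt_floor_add_one (CL * I.kappa * Real.log (d / ε))).le
    rw [numIter]; push_cast
    refine le_trans ?_ h1
    gcongr
  have h0 : 0 ≤ 1 - 1 / (2 * I.kappa) := by
    have : 1 / (2 * I.kappa) ≤ 1 := by
      rw [div_le_one (by linarith)]; linarith
    linarith
  have h2 : (1 - 1 / (2 * I.kappa)) ^ I.numIter CL ε ≤ (ε / d) ^ 10 := by
    calc _ ≤ Real.exp (-(1 / (2 * I.kappa))) ^ I.numIter CL ε := by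
          gcongr; linarith [Real.add_one_le_exp (-(1 / (2 * I.kappa)))]
      _ = Real.exp (-(I.numIter CL ε / (2 * I.kappa))) := by
          rw [← Real.exp_nat_mul]; congr 1; ring
      _ ≤ Real.exp (((10 : ℕ) : ℝ) * Real.log (ε / d)) := by
          apply Real.exp_le_exp.2
          rw [← inv_div (d : ℝ) ε, Real.log_inv, mul_neg]
          apply neg_le_neg
          rw [le_div_iff₀ (by positivity)]
          push_cast
          linarith
      _ = _ := by
          rw [Real.exp_nat_mul, Real.exp_log (by positivity)]
  have h3 : √(d : ℝ) ≤ d := by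
    rw [Real.sqrt_le_left (by linarith)]; nlinarith
  have h4 : ε ^ 9 ≤ (1 / 2) ^ 9 := by gcongr
  calc _ ≤ (ε / d) ^ 10 * (200 * d) := by gcongr
    _ = 200 * ε * ε ^ 9 / d ^ 9 := by field_simp
    -- Nine spare powers of `ε / d` outweigh the initial tangent `200 √d`, as `200 / 2⁹ < 1/2`.
    _ ≤ 200 * ε * (1 / 2) ^ 9 / 1 := by
        gcongr
        exact one_le_pow₀ hd
    _ ≤ ε / 2 := by linarith

/-- The constant in the bound on the number of actions. -/
def countConst (CL Cn : ℝ) : ℝ :=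
  2 * Cn * (2 * Real.log (10 * (CL + 2)) + 3) ^ 4 * (CL + 2)

lemma half_le_log_of_two_le {x : ℝ} (hx : 2 ≤ x) : 1 ≤ 2 * Real.log x := by
  have h1 := Real.log_two_gt_d9
  have h2 := Real.log_le_log two_pos hx
  linarith

lemma countConst_pos (hCL : 20 ≤ CL) (hCn : 1 ≤ Cn) : 0 < countConst CL Cn := by
  have : 0 ≤ Real.log (10 * (CL + 2)) := Real.log_nonneg (by linarith)
  rw [countConst]; positivity

/-- Four logarithms come from the batch size and one from the number of iterations. As `κ ≤ d /
(Δε)`, the factor `1/δ` inside the logarithm costs only a constant. -/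
lemma numActions_le (hCL : 20 ≤ CL) (hCn : 1 ≤ Cn) (hε0 : 0 < ε) (hε : ε < 1 / 2) :
    (I.numActions CL Cn ε : ℝ) ≤ countConst CL Cn *
      (I.kappa * (d : ℝ) ^ 2 / (I.gap ^ 2 * ε ^ 2)) * Real.log (d / (I.gap * ε)) ^ 5 := by
  have hk := I.one_le_kappa
  have hd := I.one_le_dim
  have hg := I.gap_pos'
  have hg1 := I.gap_le_one
  have hY := I.two_le_dim_div_gap_mul hε0 hε
  have hn := I.batchSize_le (CL := CL) hCn hε0 hε
  have hXeq := I.dim_div_eq (CL := CL) hε0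
  have hX := I.twenty_le_dim_div (CL := CL) hε0 hε
  set Y := d / (I.gap * ε) with hYdef
  set X := d / (I.delta CL ε * I.gap * ε) with hXdef
  have hΛ := half_le_log_of_two_le hY
  have hΛY : Real.log Y ≤ Y := (Real.log_le_sub_one_of_pos (by linarith)).trans (by linarith)
  set Λ := Real.log Y with hΛdef
  have hΛ0 : 0 ≤ Λ := by linarith
  have hlogd : Real.log (d / ε) ≤ Λ := by
    refine Real.log_le_log (by positivity) ?_
    rw [hYdef]
    gcongr
    nlinarith
  have hlog0 : 0 ≤ Real.log (d / ε) := Real.log_nonneg (by rw [le_div_iff₀ hε0]; linarith)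
  have hL : (I.numIter CL ε : ℝ) ≤ (CL + 2) * I.kappa * Λ := by
    have h1 := Nat.floor_le (show 0 ≤ CL * I.kappa * Real.log (d / ε) by positivity)
    rw [numIter]; push_cast
    calc _ ≤ CL * I.kappa * Λ + 1 * (2 * Λ) := by
          refine add_le_add (h1.trans (by gcongr)) (by linarith)
      _ ≤ CL * I.kappa * Λ + I.kappa * (2 * Λ) := by gcongr
      _ = _ := by ring
  have hkY : I.kappa ≤ Y := by
    refine I.kappa_le.trans ?_
    rw [hYdef, div_le_div_iff₀ hg (by positivity)]
    nlinarith
  have hℓ : Real.log X ≤ (2 * Real.log (10 * (CL + 2)) + 3) * Λ := by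
    have h1 : X ≤ 10 * (CL + 2) * Y ^ 3 := by
      rw [hXeq]
      calc 10 * (I.numIter CL ε : ℝ) * Y ≤ 10 * ((CL + 2) * Y * Y) * Y := by
            gcongr
            refine hL.trans ?_
            gcongr
        _ = _ := by ring
    have h2 := Real.log_le_log (by linarith) h1
    rw [Real.log_mul (by positivity) (by positivity), Real.log_pow] at h2
    have h3 : 0 ≤ Real.log (10 * (CL + 2)) := Real.log_nonneg (by linarith)
    push_cast at h2
    nlinarith
  have hℓ0 : 0 ≤ Real.log X := Real.log_nonneg (by linarith)
  rw [numActions]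
  push_cast
  calc (I.numIter CL ε : ℝ) * I.batchSize CL Cn ε
      ≤ ((CL + 2) * I.kappa * Λ) * (2 * (Cn * (d : ℝ) ^ 2 *
        ((2 * Real.log (10 * (CL + 2)) + 3) * Λ) ^ 4 / (I.gap ^ 2 * ε ^ 2))) := by
        refine mul_le_mul hL (hn.trans ?_) (Nat.cast_nonneg _) (by positivity)
        gcongr
    _ = _ := by rw [countConst]; ring

/-! ### Explore-then-commit -/

lemma etcEps_pos {T : ℕ} (hT : 1 ≤ T) : 0 < I.etcEps T := by
  have h1 := I.gap_pos'
  have h2 := I.one_le_kappa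
  have h3 := I.one_le_dim
  have h4 : (1 : ℝ) ≤ T := by exact_mod_cast hT
  rw [etcEps]
  exact lt_min (by norm_num) (by positivity)

lemma etcEps_lt (T : ℕ) : I.etcEps T < 1 / 2 := (min_le_left _ _).trans_lt (by norm_num)

/-- The main term of the regret bound, in terms of the uncapped accuracy. -/
lemma etc_balance {T : ℕ} (hT : 1 ≤ T) :
    T * I.lam1 * ((d : ℝ) ^ (1 / 2 : ℝ) * I.kappa ^ (1 / 4 : ℝ) /
      (I.gap ^ (1 / 2 : ℝ) * (T : ℝ) ^ (1 / 4 : ℝ))) ^ 2 = √(I.kappa ^ 3 * (d : ℝ) ^ 2 * T) := by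
  have h1 := I.gap_pos'
  have h2 := I.one_le_kappa
  have h3 := I.one_le_dim
  have h4 : (1 : ℝ) ≤ T := by exact_mod_cast hT
  have hquart {x : ℝ} (hx : 0 ≤ x) : (x ^ (1 / 4 : ℝ)) ^ 2 = √x := by
    rw [← Real.rpow_natCast, ← Real.rpow_mul hx, Real.sqrt_eq_rpow]; norm_num
  have hhalf {x : ℝ} (hx : 0 ≤ x) : (x ^ (1 / 2 : ℝ)) ^ 2 = x := by
    rw [← Real.sqrt_eq_rpow, Real.sq_sqrt hx]
  have hlam : I.lam1 = I.kappa * I.gap := by rw [kappa]; field_simp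
  rw [div_pow, mul_pow, mul_pow, hhalf (by linarith), hhalf h1.le, hquart (by linarith),
    hquart (by linarith), hlam]
  have hkk : √(I.kappa ^ 3 * (d : ℝ) ^ 2 * T) = I.kappa * √I.kappa * d * √T := by
    rw [Real.sqrt_eq_iff_mul_self_eq (by positivity) (by positivity)]
    have hk := Real.mul_self_sqrt (show 0 ≤ I.kappa by linarith)
    have ht := Real.mul_self_sqrt (show (0 : ℝ) ≤ T by linarith)
    symm
    calc _ = I.kappa ^ 2 * (√I.kappa * √I.kappa) * d ^ 2 * (√T * √T) := by ring
      _ = _ := by rw [hk, ht]; ring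
  rw [hkk]
  have ht : (T : ℝ) = √T * √T := (Real.mul_self_sqrt (by linarith)).symm
  have hst : 0 < √(T : ℝ) := by positivity
  field_simp
  rw [pow_two, ← ht]

lemma half_le_log_horizon {T : ℕ} (hT : 1 ≤ T) : 1 ≤ 2 * Real.log (2 * d * T / I.gap) := by
  have h1 := I.gap_pos'
  have h2 := I.gap_le_one
  have h3 := I.one_le_dim
  have h4 : (1 : ℝ) ≤ T := by exact_mod_cast hT
  refine half_le_log_of_two_le ?_
  rw [le_div_iff₀ h1]
  nlinarith

lemma regret_le_mul {act : ℕ → E d} {T : ℕ} (h : ∀ t < T, act t ∈ Metric.closedBall (0 : E d) 1) :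
    regret I act T ≤ 2 * (T * I.lam1) := by
  calc regret I act T ≤ ∑ _t ∈ Finset.range T, 2 * I.lam1 :=
        Finset.sum_le_sum fun t ht => I.regret_le_two (by simpa using h t (Finset.mem_range.1 ht))
    _ = _ := by simp; ring

/-- Every round is charged `e`, and those before `N` the trivial bound in addition; `N` may exceed
`T`. -/
lemma regret_le_explore_commit {act : ℕ → E d} {T N : ℕ} {e : ℝ} (he : 0 ≤ e)
    (h : ∀ t < T, act t ∈ Metric.closedBall (0 : E d) 1)
    (hN : ∀ t, N ≤ t → I.fStar - I.f (act t) ≤ e) :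
    regret I act T ≤ N * (2 * I.lam1) + T * e := by
  have hl := I.lam1_pos
  calc regret I act T ≤ ∑ t ∈ Finset.range T, ((if t < N then 2 * I.lam1 else 0) + e) := by
        refine Finset.sum_le_sum fun t ht => ?_
        split_ifs with htN
        · exact (I.regret_le_two (by simpa using h t (Finset.mem_range.1 ht))).trans (by linarith)
        · rw [zero_add]; exact hN t (not_lt.1 htN)
    _ ≤ _ := by
        rw [Finset.sum_add_distrib, ← Finset.sum_filter, Finset.sum_const, Finset.sum_const,
          Finset.card_range, nsmul_eq_mul, nsmul_eq_mul]
        gcongr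
        calc ((Finset.range T).filter (· < N)).card ≤ (Finset.range N).card :=
              Finset.card_le_card fun t ht => Finset.mem_range.2 (Finset.mem_filter.1 ht).2
          _ = N := Finset.card_range N

/-- The regret of explore-then-commit, given that all actions are feasible and that the output has
the accuracy aimed at. -/
lemma regret_le_of_accurate (hCL : 20 ≤ CL) (hCn : 1 ≤ Cn) {T : ℕ} (hT : 1 ≤ T) {act : ℕ → E d}
    (h : ∀ t < T, act t ∈ Metric.closedBall (0 : E d) 1)
    (hN : ∀ t, I.numActions CL Cn (I.etcEps T) ≤ t →
      I.fStar - I.f (act t) ≤ I.fStar * I.etcEps T ^ 2) :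
    regret I act T ≤ (2 * countConst CL Cn + 1024) * √(I.kappa ^ 3 * (d : ℝ) ^ 2 * T) *
      Real.log (2 * d * T / I.gap) ^ 5 := by
  have hg := I.gap_pos'
  have hg1 := I.gap_le_one
  have hk := I.one_le_kappa
  have hd := I.one_le_dim
  have hl := I.lam1_pos
  have hT' : (1 : ℝ) ≤ T := by exact_mod_cast hT
  have hC := countConst_pos hCL hCn
  have hbal := I.etc_balance hT
  have hΛ := I.half_le_log_horizon hT
  have hε0 := I.etcEps_pos hT
  have hε := I.etcEps_lt T
  set Q := √(I.kappa ^ 3 * (d : ℝ) ^ 2 * T)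
  set Λ := Real.log (2 * d * T / I.gap) with hΛdef
  have hQ : 0 ≤ Q := Real.sqrt_nonneg _
  have hΛ0 : 0 ≤ Λ := by linarith
  have hΛ5 : 1 ≤ 32 * Λ ^ 5 := by
    have := one_le_pow₀ hΛ (n := 5)
    rw [mul_pow] at this
    linarith
  set x := (d : ℝ) ^ (1 / 2 : ℝ) * I.kappa ^ (1 / 4 : ℝ) /
      (I.gap ^ (1 / 2 : ℝ) * (T : ℝ) ^ (1 / 4 : ℝ)) with hx
  have hx0 : 0 < x := by positivity
  -- If the cap is active, the horizon is so short that the trivial bound `2 T λ₁` already has the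
  -- right order.
  rcases le_total (1 / 4) x with hcase | hcase
  · have h1 : T * I.lam1 ≤ 16 * Q := by
      rw [← hbal]
      have h2 : 1 / 16 ≤ x ^ 2 := by nlinarith
      nlinarith [mul_le_mul_of_nonneg_left h2 (show 0 ≤ T * I.lam1 by positivity)]
    calc regret I act T ≤ 2 * (T * I.lam1) := I.regret_le_mul h
      _ ≤ 32 * Q * 1 := by linarith
      _ ≤ 32 * Q * (32 * Λ ^ 5) := by gcongr
      _ = 1024 * Q * Λ ^ 5 := by ring
      _ ≤ _ := by
          gcongr
          linarith
  · have hεx : I.etcEps T = x := min_eq_right hcase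
    have hcount := I.numActions_le (CL := CL) hCL hCn hε0 hε
    have hreg := I.regret_le_explore_commit (T := T) (N := I.numActions CL Cn (I.etcEps T))
      (e := I.fStar * I.etcEps T ^ 2) (by rw [fStar_eq]; positivity) h hN
    rw [fStar_eq] at hreg
    rw [hεx] at hcount hreg hε
    -- Needed to replace the accuracy inside the logarithm by the horizon; it follows from `T x² = Q
    -- / λ₁ ≥ 1`.
    have hxT : 1 ≤ T * x := by
      have h1 : 1 ≤ T * x ^ 2 * T := by
        have h2 : Q ≤ Q * I.lam1⁻¹ * T := by
          have h5 : 1 ≤ I.lam1⁻¹ := (one_le_inv₀ hl).2 I.lam1_le_one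
          calc Q = Q * 1 * 1 := by ring
            _ ≤ _ := by gcongr
        have h3 : Q * I.lam1⁻¹ = T * x ^ 2 := by rw [← hbal]; field_simp
        have h4 : 1 ≤ Q := by
          refine Real.one_le_sqrt.2 ?_
          calc (1 : ℝ) = 1 ^ 3 * 1 ^ 2 * 1 := by norm_num
            _ ≤ _ := by gcongr
        rw [h3] at h2
        linarith
      have h2 : 1 ≤ (T * x) ^ 2 := by linarith
      nlinarith [mul_pos (show (0 : ℝ) < T by linarith) hx0]
    have hlog : Real.log (d / (I.gap * x)) ≤ Λ := by
      refine Real.log_le_log (by positivity) ?_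
      rw [div_le_div_iff₀ (by positivity) hg]
      have : 1 ≤ 2 * (T * x) := by linarith
      calc d * I.gap = d * I.gap * 1 := by ring
        _ ≤ d * I.gap * (2 * (T * x)) := by gcongr
        _ = _ := by ring
    have hlog0 : 0 ≤ Real.log (d / (I.gap * x)) :=
      Real.log_nonneg (by linarith [I.two_le_dim_div_gap_mul hx0 hε])
    -- The choice of `x` makes the exploration cost equal the commitment cost `T λ₁ x² = Q`.
    have hmain : I.kappa * (d : ℝ) ^ 2 / (I.gap ^ 2 * x ^ 2) * I.lam1 = Q := by
      have hlam : I.lam1 = I.kappa * I.gap := by rw [kappa]; field_simp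
      have hQQ : Q * Q = I.kappa ^ 3 * (d : ℝ) ^ 2 * T := Real.mul_self_sqrt (by positivity)
      have hQ0 : 0 < Q := by positivity
      rw [hlam] at hbal ⊢
      rw [div_mul_eq_mul_div, div_eq_iff (by positivity)]
      have hT0 : (T : ℝ) * I.kappa ≠ 0 := by positivity
      apply mul_left_cancel₀ hT0
      calc _ = (I.kappa ^ 3 * (d : ℝ) ^ 2 * T) * I.gap := by ring
        _ = Q * (T * (I.kappa * I.gap) * x ^ 2) * I.gap := by rw [hbal, hQQ]
        _ = _ := by ring
    calc regret I act T ≤ I.numActions CL Cn x * (2 * I.lam1) + T * (I.lam1 * x ^ 2) := hreg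
      _ ≤ countConst CL Cn * (I.kappa * (d : ℝ) ^ 2 / (I.gap ^ 2 * x ^ 2)) * Λ ^ 5 *
          (2 * I.lam1) + Q := by
          refine add_le_add ?_ (by linarith)
          gcongr
          exact hcount.trans (by gcongr)
      _ = 2 * countConst CL Cn * (I.kappa * (d : ℝ) ^ 2 / (I.gap ^ 2 * x ^ 2) * I.lam1) * Λ ^ 5 +
          Q * 1 := by ring
      _ ≤ 2 * countConst CL Cn * Q * Λ ^ 5 + Q * (32 * Λ ^ 5) := by
          rw [hmain]; gcongr
      _ = (2 * countConst CL Cn + 32) * Q * Λ ^ 5 := by ring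
      _ ≤ _ := by
          gcongr
          norm_num

end Problem

/-! ### Success of the noisy power method -/

lemma measurableSet_forall_norm_le (d n : ℕ) :
    MeasurableSet {x : Fin n → E d | ∀ i, ‖x i‖ ≤ 1} := by
  simp only [Set.ofPred_forall]
  exact MeasurableSet.iInter fun i =>
    measurableSet_le (measurable_pi_apply i).norm measurable_const

/-- Only monotonicity and subadditivity enter, so neither set has to be measurable. -/
lemma le_measureReal_of_compl {Ω : Type*} [MeasurableSpace Ω] {P : Measure Ω}
    [IsProbabilityMeasure P] {B G : Set Ω} {p : ℝ} (hp : 0 ≤ p) (hB : P B ≤ ENNReal.ofReal p)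
    (hG : ∀ᵐ ω ∂P, ω ∉ B → ω ∈ G) : 1 - p ≤ P.real G := by
  have h1 : P.real Set.univ ≤ P.real (G ∪ B) := by
    refine ENNReal.toReal_mono (measure_ne_top _ _) (measure_mono_ae ?_)
    filter_upwards [hG] with ω hω _
    by_cases h : ω ∈ B
    · exact Or.inr h
    · exact Or.inl (hω h)
  have h2 := measureReal_union_le (μ := P) G B
  have h3 : P.real B ≤ p := ENNReal.toReal_le_of_le_ofReal hp hB
  rw [probReal_univ] at h1
  linarith

/-- A vector whose coordinates, and whose inner product with `v₁`, are close to those of a positive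
multiple of `op a` is a positive multiple of a small perturbation of `op a`. -/
lemma Problem.exists_perturbation {d : ℕ} (I : Problem d) {ε c : ℝ} (hε1 : ε ≤ 1)
    (hc : 1 / 2 ≤ c) {a y : E d}
    (hbasis : ∀ j, |⟪EuclideanSpace.basisFun (Fin d) ℝ j, y⟫ -
      c / 2 * ⟪EuclideanSpace.basisFun (Fin d) ℝ j, I.op a⟫| ≤ I.gap * ε / (25600 * √d))
    (hv : |⟪I.v1, y⟫ - c / 2 * ⟪I.v1, I.op a⟫| ≤ I.gap * ε / (25600 * √d)) :
    ∃ g : E d, ‖g‖ ≤ I.gap * (ε / 2) / 16 ∧ |⟪I.v1, g⟫| ≤ I.gap / (32 * (200 * √d)) ∧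
      y = (c / 2) • (I.op a + g) := by
  have hd := I.one_le_dim
  have hg := I.gap_pos'
  have hsd : 0 < √(d : ℝ) := Real.sqrt_pos.2 (by linarith)
  have hc0 : 0 < c := by linarith
  set τ := I.gap * ε / (25600 * √d) with hτ
  have hτ0 : 0 ≤ τ := (abs_nonneg _).trans hv
  set g : E d := (2 / c) • y - I.op a with hgdef
  have hin (u : E d) (hu : |⟪u, y⟫ - c / 2 * ⟪u, I.op a⟫| ≤ τ) : |⟪u, g⟫| ≤ 4 * τ := by
    have h1 : ⟪u, g⟫ = 2 / c * (⟪u, y⟫ - c / 2 * ⟪u, I.op a⟫) := by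
      rw [hgdef, inner_sub_right, inner_smul_right]; field_simp
    rw [h1, abs_mul, abs_of_pos (by positivity)]
    have h2 : 2 / c ≤ 4 := by rw [div_le_iff₀ hc0]; linarith
    gcongr
  -- The constant is `25600 = 4 * 32 * 200`: the rescaling `2 / c ≤ 4`, the tolerance `1 / 32` of
  -- the iteration along `v₁`, and the initial tangent `200 √d`.
  have h4τ : 4 * τ = I.gap * ε / (6400 * √d) := by rw [hτ]; field_simp; ring
  have hε0 : 0 ≤ ε := by
    have : 0 ≤ τ * (25600 * √d) := by positivity
    rw [hτ, div_mul_cancel₀ _ (by positivity)] at this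
    exact nonneg_of_mul_nonneg_right this hg
  refine ⟨g, ?_, ?_, ?_⟩
  · have h1 : ‖g‖ ^ 2 ≤ (√d * (4 * τ)) ^ 2 := by
      rw [← (EuclideanSpace.basisFun (Fin d) ℝ).sum_sq_inner_right g, mul_pow,
        Real.sq_sqrt (by linarith)]
      calc ∑ j, ⟪EuclideanSpace.basisFun (Fin d) ℝ j, g⟫ ^ 2 ≤ ∑ _j : Fin d, (4 * τ) ^ 2 :=
            Finset.sum_le_sum fun j _ => by
              rw [← sq_abs]; gcongr; exact hin _ (hbasis j)
        _ = _ := by simp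
    have h2 := (pow_le_pow_iff_left₀ (norm_nonneg _) (by positivity) two_ne_zero).1 h1
    refine h2.trans ?_
    rw [h4τ]
    have h3 : √(d : ℝ) * (I.gap * ε / (6400 * √d)) = I.gap * ε / 6400 := by field_simp
    rw [h3]
    nlinarith [mul_nonneg hg.le hε0]
  · refine (hin _ hv).trans ?_
    rw [h4τ]
    calc I.gap * ε / (6400 * √d) ≤ I.gap * 1 / (6400 * √d) := by gcongr
      _ = _ := by rw [mul_one]; congr 1; ring
  · rw [hgdef, add_sub_cancel, smul_smul]
    rw [show c / 2 * (2 / c) = 1 by field_simp, one_smul]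

namespace IsRun

variable {d : ℕ} {Ω : Type*} [mΩ : MeasurableSpace Ω] [StandardBorelSpace Ω]
  {P : Measure Ω} [IsProbabilityMeasure P] {L n : ℕ} {m : ℝ}
  {a₀ : Ω → E d} {z : ℕ → Ω → E d} {η : ℕ → Ω → ℝ}

lemma ae_norm_init (h : IsRun P L n m a₀ z η) : ∀ᵐ ω ∂P, ‖a₀ ω‖ = 1 := by
  have h1 := ae_norm_sphereUniform d
  rw [← h.law_init] at h1
  exact ae_of_ae_map h.measurable_init.aemeasurable h1

lemma ae_norm_z_le (h : IsRun P L n m a₀ z η) : ∀ᵐ ω ∂P, ∀ t < L * n, ‖z t ω‖ ≤ 1 := by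
  have hl : ∀ l < L, ∀ᵐ ω ∂P, ∀ i : Fin n, ‖z (l * n + i) ω‖ ≤ 1 := fun l hl => by
    have hm : Measurable fun ω (i : Fin n) => z (l * n + i) ω :=
      measurable_pi_lambda _ fun i => h.measurable_z _
    have h1 : ∀ᵐ x ∂(batchLaw d n m), ∀ i, ‖x i‖ ≤ 1 :=
      ae_cond_mem (measurableSet_forall_norm_le d n)
    rw [← h.law_batch l hl] at h1
    exact ae_of_ae_map hm.aemeasurable h1
  have hall : ∀ᵐ ω ∂P, ∀ l, l < L → ∀ i : Fin n, ‖z (l * n + i) ω‖ ≤ 1 :=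
    ae_all_iff.2 fun l => by
      by_cases hlL : l < L
      · exact (hl l hlL).mono fun ω hω _ => hω
      · exact ae_of_all _ fun ω h' => absurd h' hlL
  filter_upwards [hall] with ω hω t ht
  have hn : 0 < n := Nat.pos_of_ne_zero fun h0 => by simp [h0] at ht
  have h1 := hω (t / n) ((Nat.div_lt_iff_lt_mul hn).2 ht) ⟨t % n, Nat.mod_lt _ hn⟩
  rwa [Nat.div_add_mod'] at h1

lemma ae_npmAction_mem (h : IsRun P L n m a₀ z η) (f : E d → ℝ) :
    ∀ᵐ ω ∂P, ∀ t < L * n, npmAction f n m (a₀ ω) (fun s => z s ω) (fun s => η s ω) t ∈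
      Metric.closedBall (0 : E d) 1 := by
  filter_upwards [h.ae_norm_init, h.ae_norm_z_le] with ω h0 hz t ht
  have h1 := norm_npmIter_le f n m (fun s => z s ω) (fun s => η s ω) h0.le (t / n)
  have h2 := norm_add_le (npmIter f n m (a₀ ω) (fun s => z s ω) (fun s => η s ω) (t / n)) (z t ω)
  have h3 := hz t ht
  rw [mem_closedBall_zero_iff, npmAction, norm_smul]
  norm_num
  linarith

lemma ae_etcAction_mem (h : IsRun P L n m a₀ z η) (f : E d → ℝ) :
    ∀ᵐ ω ∂P, ∀ t, etcAction f L n m (a₀ ω) (fun s => z s ω) (fun s => η s ω) t ∈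
      Metric.closedBall (0 : E d) 1 := by
  filter_upwards [h.ae_norm_init, h.ae_npmAction_mem f] with ω h0 hact t
  rw [etcAction]
  split_ifs with ht
  · exact hact t ht
  · exact mem_closedBall_zero_iff.2 (norm_npmIter_le f n m _ _ h0.le L)

lemma measure_init_slab_le (h : IsRun P L n m a₀ z η) (I : Problem d) :
    P {ω | |⟪I.v1, a₀ ω⟫| < 1 / (200 * √d)} ≤ ENNReal.ofReal 0.05 := by
  have hm : MeasurableSet {x : E d | |⟪I.v1, x⟫| < 1 / (200 * √d)} :=
    measurableSet_lt (by fun_prop) measurable_const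
  have h1 := sphereUniform_slab_le I.dim_pos I.norm_v1
  have h2 : P {ω | |⟪I.v1, a₀ ω⟫| < 1 / (200 * √d)} =
      sphereUniform d {x | |⟪I.v1, x⟫| < 1 / (200 * √d)} := by
    rw [← h.law_init, Measure.map_apply h.measurable_init hm]
    rfl
  have hfin : sphereUniform d {x | |⟪I.v1, x⟫| < 1 / (200 * √d)} ≠ ∞ := by
    rw [← h2]; exact measure_ne_top _ _
  rw [h2]
  exact (ENNReal.le_ofReal_iff_toReal_le hfin (by norm_num)).2 h1

/-- Outside an event of probability at most `0.1`, the noisy power method succeeds. -/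
theorem exists_failure_set {I : Problem d} {CL Cm Cn ε : ℝ} (hCL : 20 ≤ CL) (hCm : 256 ≤ Cm)
    (hCn : (18 * (25600 ^ 2 * 4100) * Cm) ^ 2 ≤ Cn) (hε0 : 0 < ε) (hε : ε < 1 / 2)
    (h : IsRun P (I.numIter CL ε) (I.batchSize CL Cn ε) (I.precision CL Cm Cn ε) a₀ z η) :
    ∃ B : Set Ω, P B ≤ ENNReal.ofReal 0.1 ∧ ∀ᵐ ω ∂P, ω ∉ B →
      ‖npmIter I.f (I.batchSize CL Cn ε) (I.precision CL Cm Cn ε) (a₀ ω) (fun s => z s ω)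
        (fun s => η s ω) (I.numIter CL ε)‖ = 1 ∧
      I.Aligned (ε / 2) (npmIter I.f (I.batchSize CL Cn ε) (I.precision CL Cm Cn ε) (a₀ ω)
        (fun s => z s ω) (fun s => η s ω) (I.numIter CL ε)) := by
  have hCn1 : 1 ≤ Cn := by nlinarith
  have hd := I.one_le_dim
  have hg := I.gap_pos'
  have hsd : 1 ≤ √(d : ℝ) := Real.one_le_sqrt.2 hd
  have hn := I.batchSize_pos (CL := CL) hCn1 hε0 hε
  have hprec := I.precision_ge (CL := CL) hCm hCn1 hε0 hε
  have hunion := I.union_bound (CL := CL) hCm hCn hε0 hε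
  have hcontr := I.contraction_le hCL hε0 hε
  set L := I.numIter CL ε
  set n := I.batchSize CL Cn ε
  set m := I.precision CL Cm Cn ε
  set τ := I.gap * ε / (25600 * √d) with hτ
  have hτ0 : 0 < τ := by positivity
  have hτ1 : τ ≤ 1 := by
    rw [hτ, div_le_one (by positivity)]
    nlinarith [I.gap_le_one]
  have hm1 : 1 ≤ m := by linarith
  obtain ⟨c, hc, hc'⟩ := exists_secondMoment_truncGauss (by linarith) hprec I.norm_v1
  set A : ℕ → Ω → E d := fun l ω => npmIter I.f n m (a₀ ω) (fun s => z s ω) (fun s => η s ω) l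
    with hA
  set Y : ℕ → Ω → E d := fun l ω => (m / n : ℝ) • ∑ i ∈ Finset.range n,
    (I.f ((1 / 2 : ℝ) • (A l ω + z (l * n + i) ω)) + η (l * n + i) ω) • z (l * n + i) ω with hY
  -- The basis controls the norm of the error. The direction `v₁` is added because the bound through
  -- the norm would lack the factor `1 / √d` required there.
  set dir : Option (Fin d) → E d :=
    fun o => o.elim I.v1 fun j => EuclideanSpace.basisFun (Fin d) ℝ j with hdir
  have hdir1 (o : Option (Fin d)) : ‖dir o‖ = 1 := by
    cases o with
    | none => exact I.norm_v1
    | some j => exact (EuclideanSpace.basisFun (Fin d) ℝ).norm_eq_one j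
  set p : ℝ := 2 * Real.exp (-(n * τ ^ 2 / (4100 * m))) with hp
  have hp0 : 0 ≤ p := by positivity
  set D : ℕ → Option (Fin d) → Set Ω := fun l o =>
    {ω | τ ≤ |⟪dir o, Y l ω⟫ - c / 2 * ⟪dir o, I.op (A l ω)⟫|} with hD
  have hDp (l : ℕ) (hl : l < L) (o : Option (Fin d)) : P (D l o) ≤ ENNReal.ofReal p :=
    h.measure_batch_deviation_le hn hm1 (by linarith)
      (h.ae_norm_init.mono fun ω hω => hω.le) hc' hl (hdir1 o) hτ0 hτ1
  have hsum : P (⋃ l ∈ Finset.range L, ⋃ o ∈ Finset.univ, D l o) ≤ ENNReal.ofReal 0.05 := by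
    calc _ ≤ ∑ l ∈ Finset.range L, ∑ o, P (D l o) :=
          (measure_biUnion_finset_le _ _).trans
            (Finset.sum_le_sum fun l _ => measure_biUnion_finset_le _ _)
      _ ≤ ∑ l ∈ Finset.range L, ∑ _o : Option (Fin d), ENNReal.ofReal p :=
          Finset.sum_le_sum fun l hl => Finset.sum_le_sum fun o _ =>
            hDp l (Finset.mem_range.1 hl) o
      _ = ENNReal.ofReal (L * ((d + 1 : ℝ) * p)) := by
          simp only [Finset.sum_const, Finset.card_range, Finset.card_univ, Fintype.card_option,
            Fintype.card_fin, nsmul_eq_mul]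
          rw [ENNReal.ofReal_mul (Nat.cast_nonneg L), ENNReal.ofReal_natCast, ← Nat.cast_succ,
            ENNReal.ofReal_mul (p := (d.succ : ℝ)) (q := p) (Nat.cast_nonneg _),
            ENNReal.ofReal_natCast]
      _ ≤ _ := ENNReal.ofReal_le_ofReal hunion
  -- Failure is a bad start or a deviation in some batch and direction, each of probability at most
  -- `0.05`.
  refine ⟨{ω | |⟪I.v1, a₀ ω⟫| < 1 / (200 * √d)} ∪ ⋃ l ∈ Finset.range L, ⋃ o ∈ Finset.univ, D l o,
    ?_, ?_⟩
  · refine (measure_union_le _ _).trans ((add_le_add (h.measure_init_slab_le I) hsum).trans ?_)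
    rw [← ENNReal.ofReal_add (by norm_num) (by norm_num)]
    exact ENNReal.ofReal_le_ofReal (by norm_num)
  filter_upwards [h.ae_norm_init] with ω h0 hω
  simp only [Set.mem_union, Set.mem_iUnion, not_or, not_exists] at hω
  obtain ⟨hω1, hω2⟩ := hω
  have hv0 : 1 / (200 * √d) ≤ |⟪I.v1, a₀ ω⟫| := not_lt.1 hω1
  have hinit : I.Aligned (200 * √d) (A 0 ω) := by
    change I.Aligned _ (a₀ ω)
    refine ⟨abs_pos.1 (lt_of_lt_of_le (by positivity) hv0), ?_⟩
    refine ((I.norm_perp_le _).trans_eq h0).trans ?_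
    calc (1 : ℝ) = 200 * √d * (1 / (200 * √d)) := by field_simp
      _ ≤ _ := by gcongr
  have hdev (l : ℕ) (hl : l < L) (o : Option (Fin d)) :
      |⟪dir o, Y l ω⟫ - c / 2 * ⟪dir o, I.op (A l ω)⟫| ≤ τ :=
    (not_le.1 (hω2 l (Finset.mem_range.2 hl) o (Finset.mem_univ o))).le
  have hmain := I.aligned_iterate (ε := ε / 2) (R := 200 * √d) (a := fun l => A l ω) (L := L)
    hinit h0 (by positivity) (by linarith) (by linarith) fun l hl => by
      obtain ⟨g, hg1, hg2, hg3⟩ := I.exists_perturbation (by linarith) hc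
        (fun j => hdev l hl (some j)) (hdev l hl none)
      refine ⟨c / 2, g, by linarith, hg1, hg2, ?_⟩
      rw [← hg3]
      rfl
  exact ⟨hmain.1, hmain.2.mono (max_le le_rfl hcontr)⟩

end IsRun

end BanditEig

end

/-! ### The main theorem -/

open BanditEig in
theorem mainTheorem2 :
    ∃ q : ℕ, ∃ CL₀ > (0 : ℝ), ∀ CL ≥ CL₀, ∃ Cm₀ > (0 : ℝ), ∀ Cm ≥ Cm₀, ∃ Cn₀ > (0 : ℝ), ∀ Cn ≥ Cn₀,
    ∃ C > (0 : ℝ), ∀ (d : ℕ) (I : Problem d),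
      (∀ ε : ℝ, 0 < ε → ε < 1 / 2 →
        (I.numActions CL Cn ε : ℝ) ≤
          C * (I.kappa * (d : ℝ) ^ 2 / (I.gap ^ 2 * ε ^ 2)) * Real.log (d / (I.gap * ε)) ^ q ∧
        ∀ (Ω : Type*) [MeasurableSpace Ω] [StandardBorelSpace Ω]
          (P : Measure Ω) [IsProbabilityMeasure P]
          (a₀ : Ω → E d) (z : ℕ → Ω → E d) (η : ℕ → Ω → ℝ),
          IsRun P (I.numIter CL ε) (I.batchSize CL Cn ε) (I.precision CL Cm Cn ε) a₀ z η →
          (∀ᵐ ω ∂P, ∀ t < I.numActions CL Cn ε,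
            npmAction I.f (I.batchSize CL Cn ε) (I.precision CL Cm Cn ε)
              (a₀ ω) (fun s => z s ω) (fun s => η s ω) t ∈ Metric.closedBall (0 : E d) 1) ∧
          (0.9 : ℝ) ≤ P.real {ω |
            let aL := npmIter I.f (I.batchSize CL Cn ε) (I.precision CL Cm Cn ε)
              (a₀ ω) (fun s => z s ω) (fun s => η s ω) (I.numIter CL ε)
            ‖aL‖ = 1 ∧
            (∃ aStar : E d, (aStar = I.v1 ∨ aStar = -I.v1) ∧
              InnerProductGeometry.angle aStar aL < Real.pi / 2 ∧
              Real.tan (InnerProductGeometry.angle aStar aL) ≤ ε) ∧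
            I.fStar - I.f aL ≤ I.fStar * ε ^ 2}) ∧
      (∀ T : ℕ, 1 ≤ T →
        ∀ (Ω : Type*) [MeasurableSpace Ω] [StandardBorelSpace Ω]
          (P : Measure Ω) [IsProbabilityMeasure P]
          (a₀ : Ω → E d) (z : ℕ → Ω → E d) (η : ℕ → Ω → ℝ),
          IsRun P (I.numIter CL (I.etcEps T)) (I.batchSize CL Cn (I.etcEps T))
            (I.precision CL Cm Cn (I.etcEps T)) a₀ z η →
          (0.9 : ℝ) ≤ P.real {ω |
            (∀ t < T, etcAction I.f (I.numIter CL (I.etcEps T)) (I.batchSize CL Cn (I.etcEps T))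
              (I.precision CL Cm Cn (I.etcEps T)) (a₀ ω) (fun s => z s ω) (fun s => η s ω) t
                ∈ Metric.closedBall (0 : E d) 1) ∧
            regret I (etcAction I.f (I.numIter CL (I.etcEps T)) (I.batchSize CL Cn (I.etcEps T))
              (I.precision CL Cm Cn (I.etcEps T)) (a₀ ω) (fun s => z s ω) (fun s => η s ω)) T ≤
              C * √(I.kappa ^ 3 * (d : ℝ) ^ 2 * T) * Real.log (2 * d * T / I.gap) ^ q}) := by
  -- `C_m ≥ 256` ensures `m ≥ 512 d`, since `log (n/δ) ≥ 2`; the threshold for `C_n` is the one that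
  -- makes the union bound close.
  refine ⟨5, 20, by norm_num, fun CL hCL => ⟨256, by norm_num, fun Cm hCm =>
    ⟨(18 * (25600 ^ 2 * 4100) * Cm) ^ 2, by positivity, fun Cn hCn =>
    ⟨2 * Problem.countConst CL Cn + 1024, ?_, fun d I => ⟨fun ε hε0 hε => ⟨?_, ?_⟩, ?_⟩⟩⟩⟩⟩
  · have := Problem.countConst_pos (Cn := Cn) hCL (by nlinarith)
    positivity
  · have hCn1 : 1 ≤ Cn := by nlinarith
    have hC := Problem.countConst_pos hCL hCn1
    have hk := I.one_le_kappa
    have hg := I.gap_pos'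
    have hlog : 0 ≤ Real.log (d / (I.gap * ε)) :=
      Real.log_nonneg (by linarith [I.two_le_dim_div_gap_mul hε0 hε])
    refine (I.numActions_le hCL hCn1 hε0 hε).trans ?_
    gcongr
    linarith
  · intro Ω _ _ P _ a₀ z η h
    refine ⟨h.ae_npmAction_mem I.f, ?_⟩
    obtain ⟨B, hB, hgood⟩ := h.exists_failure_set hCL hCm hCn hε0 hε
    refine le_trans (by norm_num) (le_measureReal_of_compl (by norm_num) hB ?_)
    filter_upwards [hgood] with ω hω hωB
    obtain ⟨h1, h2⟩ := hω hωB
    exact ⟨h1, h2.output h1 hε0.le⟩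
  · intro T hT Ω _ _ P _ a₀ z η h
    have hε0 := I.etcEps_pos hT
    obtain ⟨B, hB, hgood⟩ := h.exists_failure_set hCL hCm hCn hε0 (I.etcEps_lt T)
    refine le_trans (by norm_num) (le_measureReal_of_compl (by norm_num) hB ?_)
    filter_upwards [hgood, h.ae_etcAction_mem I.f] with ω hω hact hωB
    obtain ⟨h1, h2⟩ := hω hωB
    refine ⟨fun t _ => hact t, I.regret_le_of_accurate hCL (by nlinarith) hT
      (fun t _ => hact t) fun t ht => ?_⟩
    rw [Problem.numActions] at ht
    rw [etcAction, if_neg (not_lt.2 ht)]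
    exact (h2.output h1 hε0.le).2
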